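/- For a $C^*$-algebra $D$ write $\mathrm{Cu}(D)$ for its Cuntz semigroup: the set of classes $\langle a\rangle$ of positive elements $a\in D\otimes\mathcal K$ under Cuntz equivalence, where $\langle a\rangle\le\langle b\rangle$ if and only if there are $d_k\in D\otimes\mathcal K$ with $d_k b d_k^*\to a$, and $\langle a\rangle+\langle b\rangle=\langle a\oplus b\rangle$ (with $M_2(\mathcal K)\cong\mathcal K$). For $u',u\in\mathrm{Cu}(D)$ write $u'\ll u$ if, whenever $u$ is the supremum of an increasing sequence $(u_i)$ in $\mathrm{Cu}(D)$, one has $u'\le u_i$ for some $i$. Let $m,n\ge 1$ be integers. An element $u\in \mathrm{Cu}(D)$ is called * *$(m,n)$-divisible* if for every $u'\ll u$ there is $x\in\mathrm{Cu}(D)$ with $mx\le u$ and $u'\le nx$; * *$(m,n)$-decomposable* if for every $u'\ll u$ there are $x_1,\dots,x_m\in\mathrm{Cu}(D)$ with $x_1+\cdots+x_m\le u$ and $u'\le nx_j$ for $j=1,\dots,m$; * *weakly $(m,n)$-divisible* if for every $u'\ll u$ there are $x_1,\dots,x_n\in\mathrm{Cu}(D)$ with $mx_j\le u$ for $j=1,\dots,n$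 and $u'\le x_1+\cdots+x_n$. A unital $C^*$-algebra $D$ is said to have one of these properties if $u=\langle 1_D\rangle$ has it. For $C^*$-algebras $A,B$ let $A\otimes B$ be the minimal (spatial) tensor product and let $\mathrm{Cu}(A)\times\mathrm{Cu}(B)\to\mathrm{Cu}(A\otimes B)$, $(x,y)\mapsto x\otimes y$, be the map given by $\langle a\rangle\otimes\langle b\rangle=\langle a\otimes b\rangle$, where $(A\otimes\mathcal K)\otimes(B\otimes\mathcal K)$ is identified with $(A\otimes B)\otimes\mathcal K$. **Lemma.** Let $A$ and $B$ be unital $C^*$-algebras and let $1\le m<n$ be integers. (i) Let $x,y\in\mathrm{Cu}(A)$ be such that $nx\le my$. If $B$ is $(m,n)$-divisible, then $x\otimes\langle 1_B\rangle\le y\otimes\langle 1_B\rangle$. (ii) Let $x_1,\dots,x_m,y\in\mathrm{Cu}(A)$ be such that $nx_j\le y$ for all $j$. If $B$ is $(m,n)$-decomposable, then $(x_1+\cdots+x_m)\otimes\langle 1_B\rangle\le y\otimes\langle 1_B\rangle$. (iii) Let $x,y_1,\dots,y_n\in\mathrm{Cu}(A)$ be such that $x\le my_j$ for all $j$. If $B$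 is weakly $(m,n)$-divisible, then $x\otimes\langle 1_B\rangle\le(y_1+\cdots+y_n)\otimes\langle 1_B\rangle$. -/

import Mathlib

open scoped TensorProduct

universe u v

noncomputable section

namespace CuntzDiv

section UniversalRepresentation

open scoped ComplexOrder ENNReal

variable (A : Type u) [CStarAlgebra A]

/-- The positive linear functionals on `A`, for the usual order of a C*-algebra. -/
abbrev PosFunctional : Type u :=
  @PositiveLinearMap ℂ A ℂ _ _ (CStarAlgebra.spectralOrder A) _ _ _ _

variable {A}

/-- The GNS Hilbert space of a positive functional. -/
def gnsSpace (φ : PosFunctional A) : Type u :=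
  letI := CStarAlgebra.spectralOrder A
  letI := CStarAlgebra.spectralOrderedRing A
  PositiveLinearMap.GNS φ

instance (φ : PosFunctional A) : NormedAddCommGroup (gnsSpace φ) :=
  letI := CStarAlgebra.spectralOrder A
  letI := CStarAlgebra.spectralOrderedRing A
  (inferInstance : NormedAddCommGroup (PositiveLinearMap.GNS φ))

instance (φ : PosFunctional A) : InnerProductSpace ℂ (gnsSpace φ) :=
  letI := CStarAlgebra.spectralOrder A
  letI := CStarAlgebra.spectralOrderedRing A
  (inferInstance : InnerProductSpace ℂ (PositiveLinearMap.GNS φ))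

instance (φ : PosFunctional A) : CompleteSpace (gnsSpace φ) :=
  letI := CStarAlgebra.spectralOrder A
  letI := CStarAlgebra.spectralOrderedRing A
  (inferInstance : CompleteSpace (PositiveLinearMap.GNS φ))

/-- The GNS representation of a positive functional. -/
def gnsRep (φ : PosFunctional A) : A →⋆ₐ[ℂ] (gnsSpace φ →L[ℂ] gnsSpace φ) :=
  letI := CStarAlgebra.spectralOrder A
  letI := CStarAlgebra.spectralOrderedRing A
  PositiveLinearMap.gnsStarAlgHom φ

theorem norm_gnsRep_le (φ : PosFunctional A) (a : A) : ‖gnsRep φ a‖ ≤ ‖a‖ :=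
  NonUnitalStarAlgHom.norm_apply_le (gnsRep φ) a

variable (A) in
/-- The Hilbert space of the universal representation of `A`: the Hilbert sum of all GNS spaces. -/
abbrev UnivSpace : Type u := lp (fun φ : PosFunctional A => gnsSpace φ) 2

theorem norm_gnsRep_apply_le (φ : PosFunctional A) (a : A) (x : gnsSpace φ) :
    ‖gnsRep φ a x‖ ≤ ‖a‖ * ‖x‖ :=
  ((gnsRep φ a).le_opNorm x).trans
    (mul_le_mul_of_nonneg_right (norm_gnsRep_le φ a) (norm_nonneg x))

theorem memlp_gnsRep (a : A) (ξ : UnivSpace A) :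
    Memℓp (fun φ => gnsRep φ a (ξ φ)) 2 := by
  refine Memℓp.mono ((lp.memℓp ξ).norm.const_smul ‖a‖) fun φ => ?_
  exact norm_gnsRep_apply_le φ a (ξ φ)

/-- The operator by which `a` acts in the universal representation. -/
def univRepOp (a : A) : UnivSpace A →L[ℂ] UnivSpace A :=
  LinearMap.mkContinuous
    { toFun := fun ξ => ⟨fun φ => gnsRep φ a (ξ φ), memlp_gnsRep a ξ⟩
      map_add' := fun ξ η => by ext φ; exact map_add (gnsRep φ a) (ξ φ) (η φ)
      map_smul' := fun c ξ => by ext φ; exact map_smul (gnsRep φ a) c (ξ φ) }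
    ‖a‖ (fun ξ => by
      have h : ‖(⟨fun φ => gnsRep φ a (ξ φ), memlp_gnsRep a ξ⟩ : UnivSpace A)‖
          ≤ ‖(‖a‖ : ℂ) • ξ‖ := by
        refine lp.norm_mono (by norm_num) fun φ => ?_
        have h2 : ‖((‖a‖ : ℂ) • ξ) φ‖ = ‖a‖ * ‖ξ φ‖ := by
          rw [lp.coeFn_smul, Pi.smul_apply, norm_smul, Complex.norm_real, norm_norm]
        rw [h2]
        exact norm_gnsRep_apply_le φ a (ξ φ)
      rwa [norm_smul, Complex.norm_real, norm_norm] at h)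

@[simp]
theorem univRepOp_apply (a : A) (ξ : UnivSpace A) (φ : PosFunctional A) :
    univRepOp a ξ φ = gnsRep φ a (ξ φ) := rfl

variable (A) in
/-- The universal representation of `A`: the direct sum of all GNS representations. -/
def univRep : A →⋆ₐ[ℂ] (UnivSpace A →L[ℂ] UnivSpace A) where
  toFun := univRepOp
  map_one' := by ext ξ φ; simp
  map_mul' a b := by ext ξ φ; simp
  map_zero' := by ext ξ φ; simp
  map_add' a b := by ext ξ φ; simp
  commutes' r := by ext ξ φ; simp [Algebra.algebraMap_eq_smul_one]
  map_star' a := by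
    rw [ContinuousLinearMap.star_eq_adjoint, ContinuousLinearMap.eq_adjoint_iff]
    intro ξ η
    rw [lp.inner_eq_tsum, lp.inner_eq_tsum]
    refine tsum_congr fun φ => ?_
    simp [map_star, ContinuousLinearMap.star_eq_adjoint, ContinuousLinearMap.adjoint_inner_left]

end UniversalRepresentation

section ConcreteAlgebra

variable {H : Type u} [NormedAddCommGroup H] [InnerProductSpace ℂ H] [CompleteSpace H]

/-- The norm-closed unital `*`-algebra of operators generated by a set of bounded operators. -/
def closedStarAlgebra (S : Set (H →L[ℂ] H)) : StarSubalgebra ℂ (H →L[ℂ] H) :=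
  (StarAlgebra.adjoin ℂ S).topologicalClosure

instance (S : Set (H →L[ℂ] H)) : CStarAlgebra (closedStarAlgebra S) :=
  StarSubalgebra.cstarAlgebra (closedStarAlgebra S)
    (h_closed := StarSubalgebra.isClosed_topologicalClosure _)

theorem subset_closedStarAlgebra {S : Set (H →L[ℂ] H)} {T : H →L[ℂ] H} (hT : T ∈ S) :
    T ∈ closedStarAlgebra S :=
  StarSubalgebra.le_topologicalClosure _ (StarAlgebra.subset_adjoin ℂ S hT)

end ConcreteAlgebra

section MinimalTensorProduct

open UniformSpace

variable (A : Type u) (B : Type v) [CStarAlgebra A] [CStarAlgebra B]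

/-- The Hilbert space tensor product of the universal representation spaces. -/
abbrev TensorSpace : Type (max u v) := Completion (UnivSpace A ⊗[ℂ] UnivSpace B)

variable {A B}

/-- The operator `π_A(a) ⊗ π_B(b)`, where `π` is the universal representation. -/
def tensorOp (a : A) (b : B) : TensorSpace A B →L[ℂ] TensorSpace A B :=
  (TensorProduct.mapL (univRep A a) (univRep B b)).completion

theorem clm_ext {E F : Type*} [SeminormedAddCommGroup E] [NormedSpace ℂ E]
    [NormedAddCommGroup F] [NormedSpace ℂ F] {f g : Completion E →L[ℂ] F}
    (h : ∀ x : E, f x = g x) : f = g := by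
  ext x
  induction x using Completion.induction_on with
  | hp => exact isClosed_eq f.continuous g.continuous
  | ih x => exact h x

theorem tensorOp_add_left (a a' : A) (b : B) :
    tensorOp (a + a') b = tensorOp a b + tensorOp a' b := by
  refine clm_ext fun x => ?_
  simp only [tensorOp, map_add, TensorProduct.mapL_add_left, _root_.add_apply,
    ContinuousLinearMap.completion_apply_coe, Completion.coe_add]

theorem tensorOp_add_right (a : A) (b b' : B) :
    tensorOp a (b + b') = tensorOp a b + tensorOp a b' := by
  refine clm_ext fun x => ?_
  simp only [tensorOp, map_add, TensorProduct.mapL_add_right, _root_.add_apply,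
    ContinuousLinearMap.completion_apply_coe, Completion.coe_add]

theorem tensorOp_smul_left (c : ℂ) (a : A) (b : B) :
    tensorOp (c • a) b = c • tensorOp a b := by
  refine clm_ext fun x => ?_
  simp only [tensorOp, map_smul, TensorProduct.mapL_smul_left, _root_.smul_apply,
    ContinuousLinearMap.completion_apply_coe, Completion.coe_smul]

theorem tensorOp_smul_right (c : ℂ) (a : A) (b : B) :
    tensorOp a (c • b) = c • tensorOp a b := by
  refine clm_ext fun x => ?_
  simp only [tensorOp, map_smul, TensorProduct.mapL_smul_right, _root_.smul_apply,
    ContinuousLinearMap.completion_apply_coe, Completion.coe_smul]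

theorem tensorOp_mul (a a' : A) (b b' : B) :
    tensorOp (a * a') (b * b') = tensorOp a b * tensorOp a' b' := by
  refine clm_ext fun x => ?_
  simp only [tensorOp, map_mul, TensorProduct.mapL_mul, mul_apply_eq_comp,
    ContinuousLinearMap.completion_apply_coe]

theorem tensorOp_one : tensorOp (1 : A) (1 : B) = 1 := by
  refine clm_ext fun x => ?_
  simp only [tensorOp, map_one, ContinuousLinearMap.one_def, TensorProduct.mapL_id_id,
    ContinuousLinearMap.completion_apply_coe, ContinuousLinearMap.id_apply]

theorem inner_mapL_left (S : UnivSpace A →L[ℂ] UnivSpace A) (T : UnivSpace B →L[ℂ] UnivSpace B)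
    (x y : UnivSpace A ⊗[ℂ] UnivSpace B) :
    inner ℂ (TensorProduct.mapL (star S) (star T) x) y = inner ℂ x (TensorProduct.mapL S T y) := by
  induction x using TensorProduct.induction_on with
  | zero => simp only [map_zero, inner_zero_left]
  | add x x' hx hx' => simp only [map_add, inner_add_left, hx, hx']
  | tmul p q =>
    induction y using TensorProduct.induction_on with
    | zero => simp only [map_zero, inner_zero_right]
    | add y y' hy hy' => simp only [map_add, inner_add_right, hy, hy']
    | tmul r s =>
      simp only [TensorProduct.mapL_tmul, TensorProduct.inner_tmul,
        ContinuousLinearMap.star_eq_adjoint, ContinuousLinearMap.adjoint_inner_left]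

theorem tensorOp_star (a : A) (b : B) : tensorOp (star a) (star b) = star (tensorOp a b) := by
  rw [ContinuousLinearMap.star_eq_adjoint, ContinuousLinearMap.eq_adjoint_iff]
  intro x y
  induction x, y using Completion.induction_on₂ with
  | hp => apply isClosed_eq <;> fun_prop
  | ih x y =>
    simp only [tensorOp, ContinuousLinearMap.completion_apply_coe, Completion.inner_coe, map_star]
    exact inner_mapL_left _ _ x y

variable (A B) in
/-- The minimal (spatial) tensor product `A ⊗ B` of two unital C*-algebras: the closed
`*`-subalgebra of `B(H_A ⊗ H_B)` generated by the operators `π_A(a) ⊗ π_B(b)`. -/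
def MinTensor : Type (max u v) :=
  closedStarAlgebra {T : TensorSpace A B →L[ℂ] TensorSpace A B |
    ∃ (a : A) (b : B), T = tensorOp a b}

instance : CStarAlgebra (MinTensor A B) :=
  (inferInstance : CStarAlgebra (closedStarAlgebra {T : TensorSpace A B →L[ℂ] TensorSpace A B |
    ∃ (a : A) (b : B), T = tensorOp a b}))

/-- The elementary tensor `a ⊗ b`. -/
def MinTensor.tmul (a : A) (b : B) : MinTensor A B :=
  ⟨tensorOp a b, subset_closedStarAlgebra ⟨a, b, rfl⟩⟩

theorem MinTensor.add_tmul (a a' : A) (b : B) : tmul (a + a') b = tmul a b + tmul a' b :=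
  Subtype.ext (tensorOp_add_left a a' b)

theorem MinTensor.tmul_add (a : A) (b b' : B) : tmul a (b + b') = tmul a b + tmul a b' :=
  Subtype.ext (tensorOp_add_right a b b')

theorem MinTensor.smul_tmul (c : ℂ) (a : A) (b : B) : tmul (c • a) b = c • tmul a b :=
  Subtype.ext (tensorOp_smul_left c a b)

theorem MinTensor.tmul_smul (c : ℂ) (a : A) (b : B) : tmul a (c • b) = c • tmul a b :=
  Subtype.ext (tensorOp_smul_right c a b)

theorem MinTensor.tmul_mul_tmul (a a' : A) (b b' : B) :
    tmul a b * tmul a' b' = tmul (a * a') (b * b') :=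
  Subtype.ext (tensorOp_mul a a' b b').symm

theorem MinTensor.star_tmul (a : A) (b : B) : star (tmul a b) = tmul (star a) (star b) :=
  Subtype.ext (tensorOp_star a b).symm

theorem MinTensor.one_def : (1 : MinTensor A B) = tmul 1 1 :=
  Subtype.ext tensorOp_one.symm

end MinimalTensorProduct
section FiniteMatrices

open Finset

variable (A : Type u) [CStarAlgebra A]

/-- The infinite matrices over `A` that vanish outside some `n × n` corner. -/
def finMatSubmodule : Submodule ℂ (Matrix ℕ ℕ A) where
  carrier := {M | ∃ n : ℕ, ∀ i j, n ≤ i ∨ n ≤ j → M i j = 0}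
  zero_mem' := ⟨0, fun _ _ _ => rfl⟩
  add_mem' := by
    rintro M N ⟨m, hM⟩ ⟨n, hN⟩
    refine ⟨max m n, fun i j h => ?_⟩
    rw [Matrix.add_apply, hM i j (h.imp (le_of_max_le_left) (le_of_max_le_left)),
      hN i j (h.imp (le_of_max_le_right) (le_of_max_le_right)), add_zero]
  smul_mem' := by
    rintro c M ⟨m, hM⟩
    exact ⟨m, fun i j h => by rw [Matrix.smul_apply, hM i j h, smul_zero]⟩

/-- The `*`-algebra `M_∞(A)`, the increasing union of the matrix algebras `M_n(A)`. -/
def FinMat : Type u := finMatSubmodule A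

/-- The matrix algebra `M_n(A)` with its C*-norm (for the usual order of `A`). -/
instance (n : ℕ) : NonUnitalCStarAlgebra (CStarMatrix (Fin n) (Fin n) A) :=
  letI := CStarAlgebra.spectralOrder A
  letI := CStarAlgebra.spectralOrderedRing A
  inferInstance

namespace FinMat

variable {A}

instance : AddCommGroup (FinMat A) := inferInstanceAs (AddCommGroup (finMatSubmodule A))

instance : Module ℂ (FinMat A) := inferInstanceAs (Module ℂ (finMatSubmodule A))

/-- The entries of a matrix in `M_∞(A)`. -/
def entries (M : FinMat A) : ℕ → ℕ → A := M.1

instance : CoeFun (FinMat A) (fun _ => ℕ → ℕ → A) := ⟨entries⟩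

/-- The element of `M_∞(A)` with given entries. -/
def mk (M : ℕ → ℕ → A) (h : ∃ n : ℕ, ∀ i j, n ≤ i ∨ n ≤ j → M i j = 0) : FinMat A := ⟨M, h⟩

theorem mk_apply (M : ℕ → ℕ → A) (h : ∃ n : ℕ, ∀ i j, n ≤ i ∨ n ≤ j → M i j = 0) (i j : ℕ) :
    mk M h i j = M i j := rfl

/-- The matrix `M` vanishes outside the upper left `n × n` corner. -/
def Bdd (n : ℕ) (M : FinMat A) : Prop := ∀ i j, n ≤ i ∨ n ≤ j → M i j = 0

theorem exists_bdd (M : FinMat A) : ∃ n, Bdd n M := M.2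

theorem Bdd.mono {n m : ℕ} {M : FinMat A} (h : Bdd n M) (hnm : n ≤ m) : Bdd m M :=
  fun i j hij => h i j (hij.imp hnm.trans hnm.trans)

theorem exists_bdd₂ (M N : FinMat A) : ∃ n, Bdd n M ∧ Bdd n N := by
  obtain ⟨m, hm⟩ := exists_bdd M
  obtain ⟨n, hn⟩ := exists_bdd N
  exact ⟨max m n, hm.mono (le_max_left _ _), hn.mono (le_max_right _ _)⟩

@[ext]
theorem ext {M N : FinMat A} (h : ∀ i j, M i j = N i j) : M = N :=
  Subtype.ext (funext fun i => funext fun j => h i j)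

@[simp] theorem zero_apply (i j : ℕ) : (0 : FinMat A) i j = 0 := rfl
@[simp] theorem add_apply (M N : FinMat A) (i j : ℕ) : (M + N) i j = M i j + N i j := rfl
@[simp] theorem neg_apply (M : FinMat A) (i j : ℕ) : (-M) i j = -M i j := rfl
@[simp] theorem sub_apply (M N : FinMat A) (i j : ℕ) : (M - N) i j = M i j - N i j := rfl
@[simp] theorem smul_apply (c : ℂ) (M : FinMat A) (i j : ℕ) : (c • M) i j = c • M i j := rfl

theorem Bdd.add {n : ℕ} {M N : FinMat A} (hM : Bdd n M) (hN : Bdd n N) : Bdd n (M + N) :=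
  fun i j h => by rw [add_apply, hM i j h, hN i j h, add_zero]

theorem finsum_mul_eq_left {n : ℕ} {M : FinMat A} (hM : Bdd n M) (N : FinMat A) (i k : ℕ) :
    ∑ᶠ j, M i j * N j k = ∑ j ∈ range n, M i j * N j k := by
  refine finsum_eq_sum_of_support_subset _ fun j hj => ?_
  by_contra hjn
  exact hj (by simp [hM i j (Or.inr (by simpa using hjn))])

theorem finsum_mul_eq_right {n : ℕ} (M : FinMat A) {N : FinMat A} (hN : Bdd n N) (i k : ℕ) :
    ∑ᶠ j, M i j * N j k = ∑ j ∈ range n, M i j * N j k := by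
  refine finsum_eq_sum_of_support_subset _ fun j hj => ?_
  by_contra hjn
  exact hj (by simp [hN j k (Or.inl (by simpa using hjn))])

/-- Matrix multiplication. -/
instance : Mul (FinMat A) where
  mul M N := mk (fun i k => ∑ᶠ j, M i j * N j k) <| by
    obtain ⟨n, hM, hN⟩ := exists_bdd₂ M N
    refine ⟨n, fun i k h => ?_⟩
    show ∑ᶠ j, M i j * N j k = 0
    rw [finsum_mul_eq_left hM]
    refine sum_eq_zero fun j _ => ?_
    rcases h with h | h
    · rw [hM i j (Or.inl h), zero_mul]
    · rw [hN j k (Or.inr h), mul_zero]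

theorem mul_apply_left {n : ℕ} {M : FinMat A} (hM : Bdd n M) (N : FinMat A) (i k : ℕ) :
    (M * N) i k = ∑ j ∈ range n, M i j * N j k := finsum_mul_eq_left hM N i k

theorem mul_apply_right {n : ℕ} (M : FinMat A) {N : FinMat A} (hN : Bdd n N) (i k : ℕ) :
    (M * N) i k = ∑ j ∈ range n, M i j * N j k := finsum_mul_eq_right M hN i k

theorem Bdd.mul {n : ℕ} {M N : FinMat A} (hM : Bdd n M) (hN : Bdd n N) : Bdd n (M * N) := by
  intro i k h
  rw [mul_apply_left hM]
  refine sum_eq_zero fun j _ => ?_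
  rcases h with h | h
  · rw [hM i j (Or.inl h), zero_mul]
  · rw [hN j k (Or.inr h), mul_zero]

instance : NonUnitalRing (FinMat A) where
  left_distrib M N P := by
    obtain ⟨n, hM⟩ := exists_bdd M
    ext i k
    simp only [add_apply, mul_apply_left hM, mul_add, sum_add_distrib]
  right_distrib M N P := by
    obtain ⟨n, hP⟩ := exists_bdd P
    ext i k
    simp only [add_apply, mul_apply_right _ hP, add_mul, sum_add_distrib]
  zero_mul M := by
    obtain ⟨n, hM⟩ := exists_bdd M
    ext i k
    simp [mul_apply_right _ hM]
  mul_zero M := by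
    obtain ⟨n, hM⟩ := exists_bdd M
    ext i k
    simp [mul_apply_left hM]
  mul_assoc M N P := by
    obtain ⟨n, hM, hN⟩ := exists_bdd₂ M N
    ext i l
    rw [mul_apply_left (hM.mul hN), mul_apply_left hM]
    simp only [mul_apply_left hM, mul_apply_left hN, sum_mul, mul_sum, mul_assoc]
    exact sum_comm

instance : IsScalarTower ℂ (FinMat A) (FinMat A) where
  smul_assoc c M N := by
    obtain ⟨n, hN⟩ := exists_bdd N
    ext i k
    simp only [smul_eq_mul, smul_apply, mul_apply_right _ hN, smul_sum, smul_mul_assoc]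

instance : SMulCommClass ℂ (FinMat A) (FinMat A) where
  smul_comm c M N := by
    obtain ⟨n, hM⟩ := exists_bdd M
    ext i k
    simp only [smul_eq_mul, smul_apply, mul_apply_left hM, smul_sum, mul_smul_comm]

theorem bdd_conjTranspose {n : ℕ} {M : FinMat A} (h : Bdd n M) (i j : ℕ)
    (hij : n ≤ i ∨ n ≤ j) : star (M j i) = 0 := by
  rw [h j i hij.symm, star_zero]

/-- The conjugate transpose. -/
instance : Star (FinMat A) where
  star M := mk (fun i j => star (M j i)) ((exists_bdd M).imp fun _ h => bdd_conjTranspose h)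

@[simp] theorem star_apply (M : FinMat A) (i j : ℕ) : (star M) i j = star (M j i) := rfl

theorem Bdd.star {n : ℕ} {M : FinMat A} (h : Bdd n M) : Bdd n (star M) := bdd_conjTranspose h

instance : StarRing (FinMat A) where
  star_involutive M := by ext; simp
  star_mul M N := by
    obtain ⟨n, hM⟩ := exists_bdd M
    ext i k
    simp only [star_apply, mul_apply_left hM, mul_apply_right _ hM.star, star_sum, star_mul]
  star_add M N := by ext; simp

instance : StarModule ℂ (FinMat A) where
  star_smul c M := by ext; simp

/-- The upper left `n × n` corner of an infinite matrix. -/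
def corner (n : ℕ) (M : FinMat A) : CStarMatrix (Fin n) (Fin n) A :=
  CStarMatrix.ofMatrix fun i j => M i j

@[simp] theorem corner_apply (n : ℕ) (M : FinMat A) (i j : Fin n) : corner n M i j = M i j := rfl

/-- The matrix obtained from an `n × n` matrix by adding zeros. -/
def padFun (n : ℕ) (X : CStarMatrix (Fin n) (Fin n) A) : FinMat A :=
  mk (fun i j => if h : i < n ∧ j < n then X ⟨i, h.1⟩ ⟨j, h.2⟩ else 0)
    ⟨n, fun i j h => dif_neg (by omega)⟩

theorem padFun_apply (n : ℕ) (X : CStarMatrix (Fin n) (Fin n) A) (i j : ℕ) :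
    padFun n X i j = if h : i < n ∧ j < n then X ⟨i, h.1⟩ ⟨j, h.2⟩ else 0 := rfl

theorem padFun_bdd (n : ℕ) (X : CStarMatrix (Fin n) (Fin n) A) : Bdd n (padFun n X) :=
  fun i j h => dif_neg (by omega)

/-- The inclusion of `M_n(A)` into `M_∞(A)`. -/
def pad (n : ℕ) : CStarMatrix (Fin n) (Fin n) A →⋆ₙₐ[ℂ] FinMat A where
  toFun := padFun n
  map_smul' c X := by
    ext i j
    by_cases h : i < n ∧ j < n <;> simp [padFun_apply, h]
  map_zero' := by
    ext i j
    by_cases h : i < n ∧ j < n <;> simp [padFun_apply, h]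
  map_add' X Y := by
    ext i j
    by_cases h : i < n ∧ j < n <;> simp [padFun_apply, h]
  map_mul' X Y := by
    ext i k
    rw [mul_apply_left (padFun_bdd n X),
      ← Fin.sum_univ_eq_sum_range (fun j => padFun n X i j * padFun n Y j k) n]
    by_cases h : i < n ∧ k < n
    · simp [padFun_apply, h, CStarMatrix.mul_apply]
    · rw [padFun_apply, dif_neg h]
      rw [not_and_or] at h
      rcases h with h | h <;> simp [padFun_apply, h]
  map_star' X := by
    ext i j
    by_cases h : i < n ∧ j < n
    · simp [padFun_apply, h, CStarMatrix.star_apply]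
    · have h' : ¬ (j < n ∧ i < n) := fun h2 => h h2.symm
      simp only [star_apply, padFun_apply, dif_neg h, dif_neg h', star_zero]

theorem pad_apply (n : ℕ) (X : CStarMatrix (Fin n) (Fin n) A) (i j : ℕ) :
    pad n X i j = if h : i < n ∧ j < n then X ⟨i, h.1⟩ ⟨j, h.2⟩ else 0 := rfl

theorem pad_bdd (n : ℕ) (X : CStarMatrix (Fin n) (Fin n) A) : Bdd n (pad n X) :=
  fun i j h => dif_neg (by omega)

theorem pad_corner {n : ℕ} {M : FinMat A} (h : Bdd n M) : pad n (corner n M) = M := by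
  ext i j
  by_cases hij : i < n ∧ j < n
  · simp [pad_apply, hij]
  · rw [pad_apply, dif_neg hij, h i j (by omega)]

theorem corner_pad (n : ℕ) (X : CStarMatrix (Fin n) (Fin n) A) : corner n (pad n X) = X := by
  ext i j
  simp [pad_apply]

theorem corner_add (n : ℕ) (M N : FinMat A) : corner n (M + N) = corner n M + corner n N := by
  ext i j; simp

theorem corner_smul (n : ℕ) (c : ℂ) (M : FinMat A) : corner n (c • M) = c • corner n M := by
  ext i j; simp

theorem corner_star (n : ℕ) (M : FinMat A) : corner n (star M) = star (corner n M) := by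
  ext i j; simp [CStarMatrix.star_apply]

theorem corner_mul {n : ℕ} {M : FinMat A} (hM : Bdd n M) (N : FinMat A) :
    corner n (M * N) = corner n M * corner n N := by
  ext i k
  rw [corner_apply, mul_apply_left hM, CStarMatrix.mul_apply,
    ← Fin.sum_univ_eq_sum_range (fun j => M i j * N j k)]
  rfl

/-- The inclusion of `M_n(A)` into `M_m(A)` for `n ≤ m`. -/
def padTo (n m : ℕ) (h : n ≤ m) :
    CStarMatrix (Fin n) (Fin n) A →⋆ₙₐ[ℂ] CStarMatrix (Fin m) (Fin m) A where
  toFun X := corner m (pad n X)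
  map_smul' c X := by rw [map_smul, corner_smul]; rfl
  map_zero' := by ext; simp
  map_add' X Y := by rw [map_add, corner_add]
  map_mul' X Y := by rw [map_mul, corner_mul ((pad_bdd n X).mono h)]
  map_star' X := by rw [map_star, corner_star]

theorem padTo_injective (n m : ℕ) (h : n ≤ m) : Function.Injective (padTo (A := A) n m h) := by
  intro X Y hXY
  have h1 : corner m (pad n X) = corner m (pad n Y) := hXY
  have h2 := congrArg (pad m) h1
  rw [pad_corner ((pad_bdd n X).mono h), pad_corner ((pad_bdd n Y).mono h)] at h2
  rw [← corner_pad n X, h2, corner_pad]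

theorem norm_corner_eq {n m : ℕ} {M : FinMat A} (hM : Bdd n M) (h : n ≤ m) :
    ‖corner m M‖ = ‖corner n M‖ := by
  have := NonUnitalStarAlgHom.norm_map (padTo (A := A) n m h) (padTo_injective n m h) (corner n M)
  rw [← this]
  show _ = ‖corner m (pad n (corner n M))‖
  rw [pad_corner hM]

/-- The C*-norm of `M_∞(A)`: the norm in `M_n(A)` of any corner outside of which the matrix
vanishes (see `norm_eq`). -/
instance : Norm (FinMat A) where
  norm M := ‖corner (exists_bdd M).choose M‖

theorem norm_eq {n : ℕ} {M : FinMat A} (h : Bdd n M) : ‖M‖ = ‖corner n M‖ := by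
  have h' := (exists_bdd M).choose_spec
  rcases le_total n (exists_bdd M).choose with hle | hle
  · exact norm_corner_eq h hle
  · exact (norm_corner_eq h' hle).symm

instance : NormedAddCommGroup (FinMat A) :=
  AddGroupNorm.toNormedAddCommGroup
    { toFun := fun M => ‖M‖
      map_zero' := by
        rw [norm_eq (n := 0) (fun _ _ _ => rfl)]
        have : corner 0 (0 : FinMat A) = 0 := by ext i; exact i.elim0
        rw [this, norm_zero]
      add_le' := fun M N => by
        obtain ⟨n, hM, hN⟩ := exists_bdd₂ M N
        rw [norm_eq hM, norm_eq hN, norm_eq (hM.add hN), corner_add]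
        exact norm_add_le _ _
      neg' := fun M => by
        obtain ⟨n, hM⟩ := exists_bdd M
        have h2 : Bdd n (-M) := fun i j h => by rw [neg_apply, hM i j h, neg_zero]
        rw [norm_eq hM, norm_eq h2]
        have : corner n (-M) = -corner n M := by ext; simp
        rw [this, norm_neg]
      eq_zero_of_map_eq_zero' := fun M h => by
        obtain ⟨n, hM⟩ := exists_bdd M
        rw [norm_eq hM, norm_eq_zero] at h
        rw [← pad_corner hM, h, map_zero] }

instance : NonUnitalNormedRing (FinMat A) where
  __ := (inferInstance : NonUnitalRing (FinMat A))
  __ := (inferInstance : NormedAddCommGroup (FinMat A))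
  norm_mul_le M N := by
    obtain ⟨n, hM, hN⟩ := exists_bdd₂ M N
    rw [norm_eq hM, norm_eq hN, norm_eq (hM.mul hN), corner_mul hM]
    exact norm_mul_le _ _

instance : NormedSpace ℂ (FinMat A) where
  norm_smul_le c M := by
    obtain ⟨n, hM⟩ := exists_bdd M
    have h2 : Bdd n (c • M) := fun i j h => by rw [smul_apply, hM i j h, smul_zero]
    rw [norm_eq hM, norm_eq h2, corner_smul]
    exact (norm_smul_le _ _)

instance : CStarRing (FinMat A) where
  norm_mul_self_le M := by
    obtain ⟨n, hM⟩ := exists_bdd M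
    rw [norm_eq hM, norm_eq (hM.star.mul hM), corner_mul hM.star, corner_star,
      CStarRing.norm_star_mul_self]

/-- Every `*`-homomorphism from `M_∞(A)` to a C*-algebra is contractive. -/
theorem norm_hom_le {D : Type*} [NonUnitalCStarAlgebra D] (θ : FinMat A →⋆ₙₐ[ℂ] D)
    (M : FinMat A) : ‖θ M‖ ≤ ‖M‖ := by
  obtain ⟨n, hM⟩ := exists_bdd M
  have h := NonUnitalStarAlgHom.norm_apply_le (θ.comp (pad n)) (corner n M)
  rw [NonUnitalStarAlgHom.comp_apply, pad_corner hM] at h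
  rwa [norm_eq hM]

end FinMat

end FiniteMatrices
section Stabilization

open UniformSpace

/-- The extension of a bounded bilinear map to the completions. -/
def bilinExt {E F G : Type*} [NormedAddCommGroup E] [NormedSpace ℂ E] [NormedAddCommGroup F]
    [NormedSpace ℂ F] [NormedAddCommGroup G] [NormedSpace ℂ G] [CompleteSpace G]
    (f : E →L[ℂ] F →L[ℂ] G) : Completion E →L[ℂ] Completion F →L[ℂ] G :=
  (f.fromCompletion.flip.fromCompletion).flip

theorem bilinExt_coe {E F G : Type*} [NormedAddCommGroup E] [NormedSpace ℂ E]
    [NormedAddCommGroup F] [NormedSpace ℂ F] [NormedAddCommGroup G] [NormedSpace ℂ G]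
    [CompleteSpace G] (f : E →L[ℂ] F →L[ℂ] G) (x : E) (y : F) :
    bilinExt f (x : Completion E) (y : Completion F) = f x y := by
  simp only [bilinExt, ContinuousLinearMap.flip_apply, ContinuousLinearMap.fromCompletion_apply_coe]

variable (A : Type u) [CStarAlgebra A]

/-- The stabilization `A ⊗ 𝒦`, where `𝒦` is the algebra of compact operators on `ℓ²(ℕ)`: the
completion of `M_∞(A)`. -/
def Stab : Type u := Completion (FinMat A)

namespace Stab

variable {A}

instance : NormedAddCommGroup (Stab A) := inferInstanceAs (NormedAddCommGroup (Completion (FinMat A)))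
instance : NormedSpace ℂ (Stab A) := inferInstanceAs (NormedSpace ℂ (Completion (FinMat A)))
instance : CompleteSpace (Stab A) := inferInstanceAs (CompleteSpace (Completion (FinMat A)))

/-- The inclusion of `M_∞(A)` into `A ⊗ 𝒦`. -/
def of : FinMat A →ₗᵢ[ℂ] Stab A := Completion.toComplₗᵢ

theorem norm_of (M : FinMat A) : ‖of M‖ = ‖M‖ := of.norm_map M

theorem continuous_of : Continuous (of : FinMat A → Stab A) := of.continuous

theorem denseRange_of : DenseRange (of : FinMat A → Stab A) := Completion.denseRange_coe

theorem induction₁ {p : Stab A → Prop} (x : Stab A) (hp : IsClosed {x | p x})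
    (ih : ∀ M : FinMat A, p (of M)) : p x :=
  Completion.induction_on x hp ih

theorem induction₂ {B : Type v} [CStarAlgebra B] {p : Stab A → Stab B → Prop}
    (x : Stab A) (y : Stab B) (hp : IsClosed {z : Stab A × Stab B | p z.1 z.2})
    (ih : ∀ (M : FinMat A) (N : FinMat B), p (of M) (of N)) : p x y :=
  Completion.induction_on₂ x y hp ih

/-- The multiplication of `A ⊗ 𝒦` as a bounded bilinear map. -/
def mulL : Stab A →L[ℂ] Stab A →L[ℂ] Stab A :=
  bilinExt ((ContinuousLinearMap.compL ℂ (FinMat A) (FinMat A) (Stab A)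
    of.toContinuousLinearMap) ∘L ContinuousLinearMap.mul ℂ (FinMat A))

instance : Mul (Stab A) := ⟨fun x y => mulL x y⟩

theorem mul_def (x y : Stab A) : x * y = mulL x y := rfl

theorem of_mul (M N : FinMat A) : of (M * N) = of M * of N :=
  (bilinExt_coe ((ContinuousLinearMap.compL ℂ (FinMat A) (FinMat A) (Stab A)
    of.toContinuousLinearMap) ∘L ContinuousLinearMap.mul ℂ (FinMat A)) M N).symm

theorem continuous_mul' : Continuous fun z : Stab A × Stab A => z.1 * z.2 :=
  (mulL (A := A)).continuous₂

instance : ContinuousMul (Stab A) := ⟨continuous_mul'⟩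

instance : Star (Stab A) := ⟨Completion.map star⟩

theorem uniformContinuous_star_finMat : UniformContinuous (star : FinMat A → FinMat A) :=
  star_isometry.uniformContinuous

theorem of_star (M : FinMat A) : of (star M) = star (of M) :=
  (Completion.map_coe uniformContinuous_star_finMat M).symm

theorem continuous_star' : Continuous fun x : Stab A => star x :=
  Completion.continuous_map

instance : NonUnitalRing (Stab A) where
  left_distrib x y z := by simp only [mul_def, map_add]
  right_distrib x y z := by simp only [mul_def, map_add, _root_.add_apply]
  zero_mul x := by simp only [mul_def, map_zero, _root_.zero_apply]
  mul_zero x := by simp only [mul_def, map_zero]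
  mul_assoc x y z := by
    refine induction₁ (p := fun x => x * y * z = x * (y * z)) x
      (isClosed_eq (by fun_prop) (by fun_prop)) fun M => ?_
    refine induction₁ (p := fun y => of M * y * z = of M * (y * z)) y
      (isClosed_eq (by fun_prop) (by fun_prop)) fun N => ?_
    refine induction₁ (p := fun z => of M * of N * z = of M * (of N * z)) z
      (isClosed_eq (by fun_prop) (by fun_prop)) fun P => ?_
    rw [← of_mul, ← of_mul, ← of_mul, ← of_mul, mul_assoc]

instance : IsScalarTower ℂ (Stab A) (Stab A) where
  smul_assoc c x y := by simp only [smul_eq_mul, mul_def, map_smul, _root_.smul_apply]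

instance : SMulCommClass ℂ (Stab A) (Stab A) where
  smul_comm c x y := by simp only [smul_eq_mul, mul_def, map_smul]

instance : NonUnitalNormedRing (Stab A) where
  __ := (inferInstance : NonUnitalRing (Stab A))
  __ := (inferInstance : NormedAddCommGroup (Stab A))
  norm_mul_le x y := by
    refine induction₂ (p := fun x y => ‖x * y‖ ≤ ‖x‖ * ‖y‖) x y
      (isClosed_le (by fun_prop) (by fun_prop)) fun M N => ?_
    rw [← of_mul, norm_of, norm_of, norm_of]
    exact norm_mul_le M N

instance : ContinuousStar (Stab A) := ⟨continuous_star'⟩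

instance : StarRing (Stab A) where
  star_involutive x := by
    refine induction₁ (p := fun x => star (star x) = x) x
      (isClosed_eq (by fun_prop) (by fun_prop)) fun M => ?_
    rw [← of_star, ← of_star, star_star]
  star_mul x y := by
    refine induction₂ (p := fun x y => star (x * y) = star y * star x) x y
      (isClosed_eq (by fun_prop) (by fun_prop)) fun M N => ?_
    rw [← of_mul, ← of_star, ← of_star, ← of_star, ← of_mul, star_mul]
  star_add x y := by
    refine induction₂ (p := fun x y => star (x + y) = star x + star y) x y
      (isClosed_eq (by fun_prop) (by fun_prop)) fun M N => ?_
    rw [← map_add, ← of_star, ← of_star, ← of_star, ← map_add, star_add]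

instance : CStarRing (Stab A) where
  norm_mul_self_le x := by
    refine induction₁ (p := fun x => ‖x‖ * ‖x‖ ≤ ‖star x * x‖) x
      (isClosed_le (by fun_prop) (by fun_prop)) fun M => ?_
    rw [← of_star, ← of_mul, norm_of, norm_of]
    exact CStarRing.norm_mul_self_le M

instance : StarModule ℂ (Stab A) where
  star_smul c x := by
    refine induction₁ (p := fun x => star (c • x) = star c • star x) x
      (isClosed_eq (continuous_star'.comp (continuous_const_smul c))
        ((continuous_const_smul (star c)).comp continuous_star')) fun M => ?_
    rw [← map_smul, ← of_star, ← of_star, ← map_smul, star_smul]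

/-- `A ⊗ 𝒦` is a C*-algebra. -/
instance : NonUnitalCStarAlgebra (Stab A) where

/-- The inclusion of `M_∞(A)` into `A ⊗ 𝒦` as a `*`-homomorphism. -/
def ofHom : FinMat A →⋆ₙₐ[ℂ] Stab A where
  toFun := of
  map_smul' := map_smul of
  map_zero' := map_zero of
  map_add' := map_add of
  map_mul' := of_mul
  map_star' := of_star

/-- A `*`-homomorphism from `M_∞(A)` to a C*-algebra as a bounded linear map. -/
def homL {D : Type*} [NonUnitalCStarAlgebra D] (θ : FinMat A →⋆ₙₐ[ℂ] D) : FinMat A →L[ℂ] D :=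
  LinearMap.mkContinuous
    { toFun := θ
      map_add' := map_add θ
      map_smul' := map_smul θ } 1
    (fun M => by rw [one_mul]; exact FinMat.norm_hom_le θ M)

/-- The bounded extension to `A ⊗ 𝒦` of a `*`-homomorphism from `M_∞(A)` to a C*-algebra. -/
def liftL {D : Type*} [NonUnitalCStarAlgebra D] (θ : FinMat A →⋆ₙₐ[ℂ] D) : Stab A →L[ℂ] D :=
  (homL θ).fromCompletion

theorem liftL_of {D : Type*} [NonUnitalCStarAlgebra D] (θ : FinMat A →⋆ₙₐ[ℂ] D) (M : FinMat A) :
    liftL θ (of M) = θ M :=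
  ContinuousLinearMap.fromCompletion_apply_coe (homL θ) M

/-- The extension to `A ⊗ 𝒦` of a `*`-homomorphism from `M_∞(A)` to a C*-algebra. -/
def lift {D : Type*} [NonUnitalCStarAlgebra D] (θ : FinMat A →⋆ₙₐ[ℂ] D) : Stab A →⋆ₙₐ[ℂ] D where
  toFun := liftL θ
  map_smul' c x := map_smul (liftL θ) c x
  map_zero' := map_zero (liftL θ)
  map_add' := map_add (liftL θ)
  map_mul' x y := by
    refine induction₂ (p := fun x y => liftL θ (x * y) = liftL θ x * liftL θ y) x y
      (isClosed_eq (by fun_prop) (by fun_prop)) fun M N => ?_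
    rw [← of_mul, liftL_of, liftL_of, liftL_of, map_mul]
  map_star' x := by
    refine induction₁ (p := fun x => liftL θ (star x) = star (liftL θ x)) x
      (isClosed_eq (by fun_prop) (by fun_prop)) fun M => ?_
    rw [← of_star, liftL_of, liftL_of, map_star]

theorem lift_of {D : Type*} [NonUnitalCStarAlgebra D] (θ : FinMat A →⋆ₙₐ[ℂ] D) (M : FinMat A) :
    lift θ (of M) = θ M := liftL_of θ M

theorem continuous_lift {D : Type*} [NonUnitalCStarAlgebra D] (θ : FinMat A →⋆ₙₐ[ℂ] D) :
    Continuous (lift θ) := (liftL θ).continuous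

end Stab

end Stabilization
section Embeddings

open Finset

variable {A : Type u} [CStarAlgebra A]

namespace FinMat

/-- The matrix with entry `M i j` at `(f i, f j)` and zeros elsewhere. -/
def embFun (f : ℕ ↪ ℕ) (M : FinMat A) : FinMat A :=
  mk (fun p q => Function.extend f (fun i => Function.extend f (fun j => M i j) 0 q) 0 p) <| by
    obtain ⟨n, hM⟩ := exists_bdd M
    refine ⟨(range n).sup (fun i => f i + 1), fun p q h => ?_⟩
    by_cases hp : ∃ i, f i = p
    · obtain ⟨i, rfl⟩ := hp
      rw [f.injective.extend_apply]
      by_cases hq : ∃ j, f j = q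
      · obtain ⟨j, rfl⟩ := hq
        rw [f.injective.extend_apply]
        refine hM i j ?_
        by_contra hc
        push Not at hc
        have h1 := le_sup (f := fun i => f i + 1) (mem_range.2 hc.1)
        have h2 := le_sup (f := fun i => f i + 1) (mem_range.2 hc.2)
        omega
      · rw [Function.extend_apply' _ _ _ hq]; rfl
    · rw [Function.extend_apply' _ _ _ hp]; rfl

theorem embFun_apply (f : ℕ ↪ ℕ) (M : FinMat A) (i j : ℕ) : embFun f M (f i) (f j) = M i j := by
  show Function.extend f (fun i => Function.extend f (fun j => M i j) 0 (f j)) 0 (f i) = _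
  rw [f.injective.extend_apply, f.injective.extend_apply]

theorem embFun_apply_left (f : ℕ ↪ ℕ) (M : FinMat A) {p : ℕ} (q : ℕ) (hp : ¬ ∃ i, f i = p) :
    embFun f M p q = 0 := by
  show Function.extend f (fun i => Function.extend f (fun j => M i j) 0 q) 0 p = _
  rw [Function.extend_apply' _ _ _ hp]; rfl

theorem embFun_apply_right (f : ℕ ↪ ℕ) (M : FinMat A) (p : ℕ) {q : ℕ} (hq : ¬ ∃ i, f i = q) :
    embFun f M p q = 0 := by
  by_cases hp : ∃ i, f i = p
  · obtain ⟨i, rfl⟩ := hp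
    show Function.extend f (fun i => Function.extend f (fun j => M i j) 0 q) 0 (f i) = _
    rw [f.injective.extend_apply, Function.extend_apply' _ _ _ hq]; rfl
  · exact embFun_apply_left f M q hp

theorem ext_range (f : ℕ ↪ ℕ) {M N : FinMat A} (h : ∀ i j, M (f i) (f j) = N (f i) (f j))
    (hl : ∀ p q, (¬ ∃ i, f i = p) → M p q = N p q)
    (hr : ∀ p q, (¬ ∃ i, f i = q) → M p q = N p q) : M = N := by
  ext p q
  by_cases hp : ∃ i, f i = p
  · by_cases hq : ∃ j, f j = q
    · obtain ⟨i, rfl⟩ := hp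
      obtain ⟨j, rfl⟩ := hq
      exact h i j
    · exact hr p q hq
  · exact hl p q hp

theorem embFun_mul (f : ℕ ↪ ℕ) (M N : FinMat A) :
    embFun f (M * N) = embFun f M * embFun f N := by
  obtain ⟨K, hK⟩ := exists_bdd (embFun f M)
  refine ext_range f (fun i k => ?_) (fun p q hp => ?_) (fun p q hq => ?_)
  · obtain ⟨n, hM⟩ := exists_bdd M
    rw [embFun_apply, mul_apply_left hM, mul_apply_left (hK.mono (le_max_left K
      ((range n).sup (fun i => f i + 1))))]
    have hsub : (range n).map f ⊆ range (max K ((range n).sup (fun i => f i + 1))) := by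
      intro q hq
      obtain ⟨j, hj, rfl⟩ := mem_map.1 hq
      have h1 := le_sup (f := fun i => f i + 1) hj
      rw [mem_range]
      omega
    rw [← sum_subset hsub, sum_map]
    · simp only [embFun_apply]
    · intro q _ hq
      by_cases hq' : ∃ j, f j = q
      · obtain ⟨j, rfl⟩ := hq'
        have hj : n ≤ j := by
          by_contra hc
          exact hq (mem_map_of_mem f (mem_range.2 (by omega)))
        rw [embFun_apply, hM i j (Or.inr hj), zero_mul]
      · rw [embFun_apply_right f M _ hq', zero_mul]
  · rw [embFun_apply_left f _ q hp, mul_apply_left hK]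
    exact (sum_eq_zero fun j _ => by rw [embFun_apply_left f _ j hp, zero_mul]).symm
  · rw [embFun_apply_right f _ p hq, mul_apply_left hK]
    exact (sum_eq_zero fun j _ => by rw [embFun_apply_right f _ j hq, mul_zero]).symm

/-- `embFun` as a `*`-homomorphism. -/
def emb (f : ℕ ↪ ℕ) : FinMat A →⋆ₙₐ[ℂ] FinMat A where
  toFun := embFun f
  map_smul' c M := by
    refine ext_range f (fun i k => ?_) (fun p q hp => ?_) (fun p q hq => ?_)
    · simp [embFun_apply]
    · simp [embFun_apply_left f _ _ hp]
    · simp [embFun_apply_right f _ _ hq]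
  map_zero' := by
    refine ext_range f (fun i k => ?_) (fun p q hp => ?_) (fun p q hq => ?_)
    · simp [embFun_apply]
    · simp [embFun_apply_left f _ _ hp]
    · simp [embFun_apply_right f _ _ hq]
  map_add' M N := by
    refine ext_range f (fun i k => ?_) (fun p q hp => ?_) (fun p q hq => ?_)
    · simp [embFun_apply]
    · simp [embFun_apply_left f _ _ hp]
    · simp [embFun_apply_right f _ _ hq]
  map_mul' := embFun_mul f
  map_star' M := by
    refine ext_range f (fun i k => ?_) (fun p q hp => ?_) (fun p q hq => ?_)
    · simp [embFun_apply]
    · simp [embFun_apply_left f _ _ hp, embFun_apply_right f _ _ hp]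
    · simp [embFun_apply_left f _ _ hq, embFun_apply_right f _ _ hq]

theorem emb_eq (f : ℕ ↪ ℕ) (M : FinMat A) : emb f M = embFun f M := rfl

theorem emb_emb (f g : ℕ ↪ ℕ) (M : FinMat A) : emb g (emb f M) = emb (f.trans g) M := by
  simp only [emb_eq]
  refine ext_range (f.trans g) (fun i k => ?_) (fun p q hp => ?_) (fun p q hq => ?_)
  · rw [embFun_apply]
    simp only [Function.Embedding.trans_apply, embFun_apply]
  · rw [embFun_apply_left _ _ q hp]
    by_cases h : ∃ j, g j = p
    · obtain ⟨j, rfl⟩ := h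
      have hj : ¬ ∃ i, f i = j := fun ⟨i, hi⟩ => hp ⟨i, by simp [hi]⟩
      by_cases h' : ∃ l, g l = q
      · obtain ⟨l, rfl⟩ := h'
        rw [embFun_apply, embFun_apply_left _ _ l hj]
      · rw [embFun_apply_right _ _ _ h']
    · rw [embFun_apply_left _ _ _ h]
  · rw [embFun_apply_right _ _ p hq]
    by_cases h : ∃ j, g j = q
    · obtain ⟨j, rfl⟩ := h
      have hj : ¬ ∃ i, f i = j := fun ⟨i, hi⟩ => hq ⟨i, by simp [hi]⟩
      by_cases h' : ∃ l, g l = p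
      · obtain ⟨l, rfl⟩ := h'
        rw [embFun_apply, embFun_apply_right _ _ l hj]
      · rw [embFun_apply_left _ _ _ h']
    · rw [embFun_apply_right _ _ _ h]

theorem emb_mul_emb_eq_zero {f g : ℕ ↪ ℕ} (hfg : ∀ i j, f i ≠ g j) (M N : FinMat A) :
    emb f M * emb g N = 0 := by
  obtain ⟨K, hK⟩ := exists_bdd (emb f M)
  ext p q
  rw [mul_apply_left hK]
  refine sum_eq_zero fun r _ => ?_
  by_cases hr : ∃ i, f i = r
  · have hr' : ¬ ∃ j, g j = r := fun ⟨j, hj⟩ => by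
      obtain ⟨i, hi⟩ := hr
      exact hfg i j (hi.trans hj.symm)
    rw [emb_eq, emb_eq, embFun_apply_left g _ _ hr', mul_zero]
  · rw [emb_eq, embFun_apply_right f _ _ hr, zero_mul]

/-- The partial isometry with entries `1` at `(f i, i)` for `i < n`. -/
def shift (f : ℕ ↪ ℕ) (n : ℕ) : FinMat A :=
  mk (fun p q => if p = f q ∧ q < n then 1 else 0) <| by
    refine ⟨max n ((range n).sup (fun i => f i + 1)), fun p q h => ?_⟩
    refine if_neg fun hc => ?_
    have h1 := le_sup (f := fun i => f i + 1) (mem_range.2 hc.2)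
    omega

theorem shift_apply (f : ℕ ↪ ℕ) (n p q : ℕ) :
    (shift f n : FinMat A) p q = if p = f q ∧ q < n then 1 else 0 := rfl

theorem shift_mul_apply (f : ℕ ↪ ℕ) {n : ℕ} {M : FinMat A} (hM : Bdd n M) (i q : ℕ) :
    (shift f n * M : FinMat A) (f i) q = M i q := by
  rw [mul_apply_right _ (hM), ]
  rw [sum_eq_single i]
  · by_cases hi : i < n
    · simp [shift_apply, hi]
    · simp [shift_apply, hi, hM i q (Or.inl (by omega))]
  · intro j _ hj
    simp [shift_apply, (Ne.symm hj)]
  · intro hi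
    rw [hM i q (Or.inl (by simpa using hi)), mul_zero]

theorem shift_mul_apply' (f : ℕ ↪ ℕ) (n : ℕ) (M : FinMat A) {p : ℕ} (q : ℕ)
    (hp : ¬ ∃ i, f i = p) : (shift f n * M : FinMat A) p q = 0 := by
  obtain ⟨K, hK⟩ := exists_bdd (shift f n : FinMat A)
  rw [mul_apply_left hK]
  refine sum_eq_zero fun r _ => ?_
  rw [shift_apply, if_neg (fun h => hp ⟨r, h.1.symm⟩), zero_mul]

theorem shift_mul_mul_star (f : ℕ ↪ ℕ) {n : ℕ} {M : FinMat A} (hM : Bdd n M) :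
    shift f n * M * star (shift f n) = emb f M := by
  have hs : shift f n * M * star (shift f n) = star (shift f n * star (shift f n * M)) := by
    simp
  refine ext_range f (fun i k => ?_) (fun p q hp => ?_) (fun p q hq => ?_)
  · rw [emb_eq, embFun_apply, hs, star_apply]
    obtain ⟨K, hK⟩ := exists_bdd (shift f n * M)
    have hB : ∀ a b, n ≤ b → (shift f n * M : FinMat A) a b = 0 := by
      intro a b hb
      obtain ⟨L, hL⟩ := exists_bdd (shift f n : FinMat A)
      rw [mul_apply_left hL]
      exact sum_eq_zero fun r _ => by rw [hM r b (Or.inr hb), mul_zero]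
    rw [mul_apply_right _ hK.star]
    rw [sum_eq_single k]
    · by_cases hk : k < n
      · simp only [shift_apply, hk, and_self, if_true, one_mul, star_apply, star_star]
        exact shift_mul_apply f hM i k
      · rw [hM i k (Or.inr (by omega)), star_apply, hB _ _ (by omega)]
        simp
    · intro j _ hj
      simp [shift_apply, (Ne.symm hj)]
    · intro hk
      rw [star_apply, hK _ k (Or.inr (by simpa using hk))]
      simp
  · rw [emb_eq, embFun_apply_left f _ q hp, mul_assoc, shift_mul_apply' f n _ q hp]
  · rw [emb_eq, embFun_apply_right f _ p hq, hs, star_apply, shift_mul_apply' f n _ p hq, star_zero]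

theorem star_shift_mul_shift_apply (f : ℕ ↪ ℕ) (n i j : ℕ) :
    (star (shift f n) * shift f n : FinMat A) i j = if i = j ∧ j < n then 1 else 0 := by
  obtain ⟨K, hK⟩ := exists_bdd (shift f n : FinMat A)
  rw [mul_apply_left hK.star]
  by_cases h : i = j ∧ j < n
  · obtain ⟨rfl, h⟩ := h
    rw [sum_eq_single (f i)]
    · simp [shift_apply, h]
    · intro p _ hp
      simp [shift_apply, hp]
    · intro hp
      rw [star_apply, hK (f i) i (Or.inl (by simpa using hp))]
      simp
  · rw [if_neg h]
    refine sum_eq_zero fun p _ => ?_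
    simp only [star_apply, shift_apply]
    by_cases h1 : p = f i ∧ i < n
    · by_cases h2 : p = f j ∧ j < n
      · exact absurd ⟨f.injective (h1.1.symm.trans h2.1), h2.2⟩ h
      · rw [if_neg h2, mul_zero]
    · rw [if_neg h1, star_zero, zero_mul]

theorem star_shift_mul_shift_mul (f : ℕ ↪ ℕ) {n : ℕ} {M : FinMat A} (hM : Bdd n M) :
    star (shift f n) * shift f n * M = M := by
  ext i j
  rw [mul_apply_right _ hM]
  simp only [star_shift_mul_shift_apply]
  rw [sum_eq_single i]
  · by_cases hi : i < n
    · simp [hi]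
    · simp [hi, hM i j (Or.inl (by omega))]
  · intro k _ hk
    simp [Ne.symm hk]
  · intro hi
    rw [hM i j (Or.inl (by simpa using hi)), mul_zero]

theorem mul_star_shift_mul_shift (f : ℕ ↪ ℕ) {n : ℕ} {M : FinMat A} (hM : Bdd n M) :
    M * (star (shift f n) * shift f n) = M := by
  have h := congrArg star (star_shift_mul_shift_mul f hM.star)
  simpa [mul_assoc] using h

theorem star_shift_mul_emb_mul (f : ℕ ↪ ℕ) {n : ℕ} {M : FinMat A} (hM : Bdd n M) :
    star (shift f n) * emb f M * shift f n = M := by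
  rw [← shift_mul_mul_star f hM]
  calc star (shift f n) * (shift f n * M * star (shift f n)) * shift f n
      = (star (shift f n) * shift f n * M) * (star (shift f n) * shift f n) := by
        simp only [mul_assoc]
    _ = M := by rw [star_shift_mul_shift_mul f hM, mul_star_shift_mul_shift f hM]

theorem norm_shift_le (f : ℕ ↪ ℕ) (n : ℕ) : ‖(shift f n : FinMat A)‖ ≤ 1 := by
  set P : FinMat A := star (shift f n) * shift f n with hP
  have hb : Bdd n P := by
    intro i j h
    rw [hP, star_shift_mul_shift_apply, if_neg (by omega)]
  have h1 : star P * P = P := by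
    have : star P = P := by simp [hP]
    rw [this]
    exact star_shift_mul_shift_mul f hb
  have h2 : ‖P‖ * ‖P‖ = ‖P‖ := by rw [← CStarRing.norm_star_mul_self (x := P), h1]
  have h3 : ‖P‖ ≤ 1 := by
    by_contra hc
    push Not at hc
    nlinarith
  have h4 : ‖P‖ = ‖(shift f n : FinMat A)‖ * ‖(shift f n : FinMat A)‖ :=
    CStarRing.norm_star_mul_self
  by_contra hc
  push Not at hc
  nlinarith

end FinMat

namespace Stab

/-- The `*`-endomorphism of `A ⊗ 𝒦` moving the entry at `(i, j)` to `(f i, f j)`, that is,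
`x ↦ (1 ⊗ s) x (1 ⊗ s)*` for the isometry `s` of `ℓ²(ℕ)` with `s eᵢ = e_(f i)`. -/
def emb (f : ℕ ↪ ℕ) : Stab A →⋆ₙₐ[ℂ] Stab A := lift (ofHom.comp (FinMat.emb f))

theorem emb_of (f : ℕ ↪ ℕ) (M : FinMat A) : emb f (of M) = of (FinMat.emb f M) := lift_of _ M

theorem continuous_emb (f : ℕ ↪ ℕ) : Continuous (emb f : Stab A → Stab A) := continuous_lift _

theorem norm_emb_le (f : ℕ ↪ ℕ) (x : Stab A) : ‖emb f x‖ ≤ ‖x‖ :=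
  NonUnitalStarAlgHom.norm_apply_le (emb f) x

theorem emb_emb (f g : ℕ ↪ ℕ) (x : Stab A) : emb g (emb f x) = emb (f.trans g) x := by
  refine induction₁ (p := fun x => emb g (emb f x) = emb (f.trans g) x) x
    (isClosed_eq ((continuous_emb g).comp (continuous_emb f)) (continuous_emb _)) fun M => ?_
  rw [emb_of, emb_of, emb_of, FinMat.emb_emb]

theorem emb_mul_emb_eq_zero {f g : ℕ ↪ ℕ} (hfg : ∀ i j, f i ≠ g j) (x y : Stab A) :
    emb f x * emb g y = 0 := by
  refine induction₂ (p := fun x y => emb f x * emb g y = 0) x y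
    (isClosed_eq (((continuous_emb f).comp continuous_fst).mul
      ((continuous_emb g).comp continuous_snd)) continuous_const) fun M N => ?_
  rw [emb_of, emb_of, ← of_mul, FinMat.emb_mul_emb_eq_zero hfg, map_zero]

end Stab

end Embeddings
section CuntzSemigroup

variable {A : Type u} [CStarAlgebra A]

/-- Cuntz subequivalence in `A ⊗ 𝒦`: `a` is a limit of elements of the form `d b d*`. -/
def CuntzLE (a b : Stab A) : Prop := ∀ ε : ℝ, 0 < ε → ∃ d : Stab A, ‖d * b * star d - a‖ < ε

theorem CuntzLE.trans {a b c : Stab A} (hab : CuntzLE a b) (hbc : CuntzLE b c) : CuntzLE a c := by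
  intro ε hε
  obtain ⟨d, hd⟩ := hab (ε / 2) (by positivity)
  obtain ⟨e, he⟩ := hbc (ε / 2 / (‖d‖ * ‖d‖ + 1)) (by positivity)
  refine ⟨d * e, ?_⟩
  have h1 : d * e * c * star (d * e) - a
      = d * (e * c * star e - b) * star d + (d * b * star d - a) := by
    simp only [star_mul, mul_sub, sub_mul, mul_assoc]
    abel
  have h2 : ‖d * (e * c * star e - b) * star d‖ ≤ ε / 2 := by
    calc ‖d * (e * c * star e - b) * star d‖
        ≤ ‖d‖ * ‖e * c * star e - b‖ * ‖star d‖ :=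
          (norm_mul_le _ _).trans (mul_le_mul_of_nonneg_right (norm_mul_le _ _) (norm_nonneg _))
      _ = (‖d‖ * ‖d‖) * ‖e * c * star e - b‖ := by rw [norm_star]; ring
      _ ≤ (‖d‖ * ‖d‖ + 1) * (ε / 2 / (‖d‖ * ‖d‖ + 1)) := by
          gcongr
          linarith
      _ = ε / 2 := by field_simp
  rw [h1]
  linarith [norm_add_le (d * (e * c * star e - b) * star d) (d * b * star d - a)]

/-- If `T` is implemented on `M_∞(A)` by compressing the values of `S` with contractions, then
`T a ≾ S a` for all `a`. -/
theorem cuntzLE_of_implemented {T S : Stab A →⋆ₙₐ[ℂ] Stab A}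
    (h : ∀ M : FinMat A, ∃ d : FinMat A, ‖d‖ ≤ 1 ∧
      Stab.of d * S (Stab.of M) * star (Stab.of d) = T (Stab.of M)) (a : Stab A) :
    CuntzLE (T a) (S a) := by
  intro ε hε
  obtain ⟨M, hM⟩ := Stab.denseRange_of.exists_dist_lt a (half_pos hε)
  obtain ⟨d, hd1, hd⟩ := h M
  refine ⟨Stab.of d, ?_⟩
  rw [dist_eq_norm] at hM
  have h1 : Stab.of d * S a * star (Stab.of d) - T a
      = Stab.of d * S (a - Stab.of M) * star (Stab.of d) - T (a - Stab.of M) := by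
    rw [map_sub, map_sub, mul_sub, sub_mul, hd]
    abel
  have h2 : ‖Stab.of d * S (a - Stab.of M) * star (Stab.of d)‖ ≤ ‖a - Stab.of M‖ := by
    calc ‖Stab.of d * S (a - Stab.of M) * star (Stab.of d)‖
        ≤ ‖Stab.of d‖ * ‖S (a - Stab.of M)‖ * ‖star (Stab.of d)‖ :=
          (norm_mul_le _ _).trans (mul_le_mul_of_nonneg_right (norm_mul_le _ _) (norm_nonneg _))
      _ ≤ 1 * ‖a - Stab.of M‖ * 1 := by
          rw [norm_star, Stab.norm_of]
          gcongr
          exact NonUnitalStarAlgHom.norm_apply_le S _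
      _ = ‖a - Stab.of M‖ := by ring
  have h3 : ‖T (a - Stab.of M)‖ ≤ ‖a - Stab.of M‖ := NonUnitalStarAlgHom.norm_apply_le T _
  rw [h1]
  linarith [norm_sub_le (Stab.of d * S (a - Stab.of M) * star (Stab.of d)) (T (a - Stab.of M))]

theorem cuntzLE_emb (f : ℕ ↪ ℕ) (a : Stab A) : CuntzLE (Stab.emb f a) a := by
  refine cuntzLE_of_implemented (T := Stab.emb f) (S := NonUnitalStarAlgHom.id ℂ (Stab A))
    (fun M => ?_) a
  obtain ⟨n, hM⟩ := FinMat.exists_bdd M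
  refine ⟨FinMat.shift f n, FinMat.norm_shift_le f n, ?_⟩
  change Stab.of _ * Stab.of M * star (Stab.of _) = _
  rw [← Stab.of_star, ← Stab.of_mul, ← Stab.of_mul,
    FinMat.shift_mul_mul_star f hM, Stab.emb_of]

theorem emb_cuntzLE (f : ℕ ↪ ℕ) (a : Stab A) : CuntzLE a (Stab.emb f a) := by
  refine cuntzLE_of_implemented (T := NonUnitalStarAlgHom.id ℂ (Stab A)) (S := Stab.emb f)
    (fun M => ?_) a
  obtain ⟨n, hM⟩ := FinMat.exists_bdd M
  refine ⟨star (FinMat.shift f n), (norm_star _).trans_le (FinMat.norm_shift_le f n), ?_⟩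
  change _ = Stab.of M
  rw [← Stab.of_star, star_star, Stab.emb_of, ← Stab.of_mul,
    ← Stab.of_mul, FinMat.star_shift_mul_emb_mul f hM]

theorem CuntzLE.refl (a : Stab A) : CuntzLE a a :=
  (emb_cuntzLE (Function.Embedding.refl ℕ) a).trans (cuntzLE_emb _ a)

/-- The embedding `n ↦ 2n`. -/
def evenEmb : ℕ ↪ ℕ := ⟨fun n => 2 * n, fun a b h => by simpa using h⟩

/-- The embedding `n ↦ 2n + 1`. -/
def oddEmb : ℕ ↪ ℕ := ⟨fun n => 2 * n + 1, fun a b h => by simpa using h⟩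

theorem evenEmb_ne_oddEmb (i j : ℕ) : evenEmb i ≠ oddEmb j := by
  show 2 * i ≠ 2 * j + 1
  omega

/-- The orthogonal sum `a ⊕ b` in `A ⊗ 𝒦`, formed by means of the decomposition of `ℓ²(ℕ)` into
its even and its odd part. -/
def dsum (a b : Stab A) : Stab A := Stab.emb evenEmb a + Stab.emb oddEmb b

theorem dsum_mul (a b c d : Stab A) : dsum a b * dsum c d = dsum (a * c) (b * d) := by
  simp only [dsum, add_mul, mul_add, map_mul, Stab.emb_mul_emb_eq_zero evenEmb_ne_oddEmb,
    Stab.emb_mul_emb_eq_zero (fun i j => (evenEmb_ne_oddEmb j i).symm)]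
  abel

theorem star_dsum (a b : Stab A) : star (dsum a b) = dsum (star a) (star b) := by
  simp only [dsum, star_add, map_star]

theorem dsum_sub (a b c d : Stab A) : dsum a b - dsum c d = dsum (a - c) (b - d) := by
  simp only [dsum, map_sub]
  abel

theorem norm_dsum_le (a b : Stab A) : ‖dsum a b‖ ≤ ‖a‖ + ‖b‖ :=
  (norm_add_le _ _).trans (add_le_add (Stab.norm_emb_le _ a) (Stab.norm_emb_le _ b))

theorem CuntzLE.dsum {a b c d : Stab A} (hac : CuntzLE a c) (hbd : CuntzLE b d) :
    CuntzLE (dsum a b) (dsum c d) := by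
  intro ε hε
  obtain ⟨x, hx⟩ := hac (ε / 2) (by positivity)
  obtain ⟨y, hy⟩ := hbd (ε / 2) (by positivity)
  refine ⟨CuntzDiv.dsum x y, ?_⟩
  rw [dsum_mul, star_dsum, dsum_mul, dsum_sub]
  linarith [norm_dsum_le (x * c * star x - a) (y * d * star y - b)]

/-- A permutation carrying the blocks of `(a ⊕ b) ⊕ c` to those of `a ⊕ (b ⊕ c)`. -/
def assocEmb : ℕ ↪ ℕ :=
  ⟨fun n => if n % 4 = 0 then n / 2 else if n % 4 = 2 then n - 1 else 2 * n + 1, fun a b h => by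
    simp only at h
    split_ifs at h <;> omega⟩

/-- The permutation exchanging even and odd numbers. -/
def swapEmb : ℕ ↪ ℕ :=
  ⟨fun n => if n % 2 = 0 then n + 1 else n - 1, fun a b h => by
    simp only at h
    split_ifs at h <;> omega⟩

theorem evenEmb_apply (n : ℕ) : evenEmb n = 2 * n := rfl

theorem oddEmb_apply (n : ℕ) : oddEmb n = 2 * n + 1 := rfl

theorem assocEmb_apply (n : ℕ) :
    assocEmb n = if n % 4 = 0 then n / 2 else if n % 4 = 2 then n - 1 else 2 * n + 1 := rfl

theorem swapEmb_apply (n : ℕ) : swapEmb n = if n % 2 = 0 then n + 1 else n - 1 := rfl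

theorem emb_assocEmb_dsum (a b c : Stab A) :
    Stab.emb assocEmb (dsum (dsum a b) c) = dsum a (dsum b c) := by
  have h1 : (evenEmb.trans evenEmb).trans assocEmb = evenEmb := by
    ext n
    simp only [Function.Embedding.trans_apply, evenEmb_apply, assocEmb_apply]
    split_ifs <;> omega
  have h2 : (oddEmb.trans evenEmb).trans assocEmb = evenEmb.trans oddEmb := by
    ext n
    simp only [Function.Embedding.trans_apply, evenEmb_apply, oddEmb_apply, assocEmb_apply]
    split_ifs <;> omega
  have h3 : oddEmb.trans assocEmb = oddEmb.trans oddEmb := by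
    ext n
    simp only [Function.Embedding.trans_apply, oddEmb_apply, assocEmb_apply]
    split_ifs <;> omega
  simp only [dsum, map_add, Stab.emb_emb, h1, h2, h3]
  abel

theorem emb_swapEmb_dsum (a b : Stab A) : Stab.emb swapEmb (dsum a b) = dsum b a := by
  have h1 : evenEmb.trans swapEmb = oddEmb := by
    ext n
    simp only [Function.Embedding.trans_apply, evenEmb_apply, oddEmb_apply, swapEmb_apply]
    split_ifs <;> omega
  have h2 : oddEmb.trans swapEmb = evenEmb := by
    ext n
    simp only [Function.Embedding.trans_apply, evenEmb_apply, oddEmb_apply, swapEmb_apply]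
    split_ifs <;> omega
  simp only [dsum, map_add, Stab.emb_emb, h1, h2]
  abel

variable (A) in
/-- The positive elements of `A ⊗ 𝒦`. -/
structure Pos where
  /-- The underlying element. -/
  val : Stab A
  /-- Positivity. -/
  pos : ∃ c : Stab A, val = star c * c

/-- Cuntz subequivalence as a preorder. -/
instance : Preorder (Pos A) where
  le a b := CuntzLE a.val b.val
  le_refl a := CuntzLE.refl a.val
  le_trans _ _ _ := CuntzLE.trans

theorem Pos.le_def (a b : Pos A) : a ≤ b ↔ CuntzLE a.val b.val := Iff.rfl

/-- The orthogonal sum of positive elements. -/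
def Pos.dsum (a b : Pos A) : Pos A := ⟨CuntzDiv.dsum a.val b.val, by
  obtain ⟨c, hc⟩ := a.pos
  obtain ⟨d, hd⟩ := b.pos
  exact ⟨CuntzDiv.dsum c d, by rw [star_dsum, dsum_mul, hc, hd]⟩⟩

variable (A) in
/-- The Cuntz semigroup `Cu(A)`: the Cuntz equivalence classes of positive elements in `A ⊗ 𝒦`,
where `a` and `b` are equivalent if `a ≾ b` and `b ≾ a`, ordered by Cuntz subequivalence. -/
def Cu : Type u := Antisymmetrization (Pos A) (· ≤ ·)

instance : PartialOrder (Cu A) :=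
  inferInstanceAs (PartialOrder (Antisymmetrization (Pos A) (· ≤ ·)))

/-- The Cuntz class `⟨a⟩` of a positive element. -/
def Cu.mk (a : Pos A) : Cu A := toAntisymmetrization (· ≤ ·) a

theorem Cu.mk_le_mk {a b : Pos A} : Cu.mk a ≤ Cu.mk b ↔ CuntzLE a.val b.val := Iff.rfl

theorem Cu.mk_eq_mk {a b : Pos A} : Cu.mk a = Cu.mk b ↔ CuntzLE a.val b.val ∧ CuntzLE b.val a.val := by
  rw [le_antisymm_iff, Cu.mk_le_mk, Cu.mk_le_mk]

theorem Cu.ind {p : Cu A → Prop} (h : ∀ a : Pos A, p (Cu.mk a)) (x : Cu A) : p x :=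
  Quotient.inductionOn' x h

instance : Zero (Cu A) := ⟨Cu.mk ⟨0, 0, by rw [mul_zero]⟩⟩

/-- The addition `⟨a⟩ + ⟨b⟩ = ⟨a ⊕ b⟩`. -/
instance : Add (Cu A) :=
  ⟨Quotient.map₂ Pos.dsum fun _ _ h _ _ h' => ⟨CuntzLE.dsum h.1 h'.1, CuntzLE.dsum h.2 h'.2⟩⟩

theorem Cu.mk_add_mk (a b : Pos A) : Cu.mk a + Cu.mk b = Cu.mk (Pos.dsum a b) := rfl

theorem Cu.zero_def : (0 : Cu A) = Cu.mk ⟨0, 0, by rw [mul_zero]⟩ := rfl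

theorem Cu.add_comm' (x y : Cu A) : x + y = y + x := by
  induction x using Cu.ind with | _ a
  induction y using Cu.ind with | _ b
  rw [Cu.mk_add_mk, Cu.mk_add_mk, Cu.mk_eq_mk]
  have h := emb_swapEmb_dsum a.val b.val
  constructor
  · have := emb_cuntzLE swapEmb (dsum a.val b.val)
    rwa [h] at this
  · have := cuntzLE_emb swapEmb (dsum a.val b.val)
    rwa [h] at this

theorem Cu.add_zero' (x : Cu A) : x + 0 = x := by
  induction x using Cu.ind with | _ a
  rw [Cu.zero_def, Cu.mk_add_mk, Cu.mk_eq_mk]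
  have h : dsum a.val 0 = Stab.emb evenEmb a.val := by rw [dsum, map_zero, add_zero]
  constructor
  · have := cuntzLE_emb evenEmb a.val
    rwa [← h] at this
  · have := emb_cuntzLE evenEmb a.val
    rwa [← h] at this

theorem Cu.add_assoc' (x y z : Cu A) : x + y + z = x + (y + z) := by
  induction x using Cu.ind with | _ a
  induction y using Cu.ind with | _ b
  induction z using Cu.ind with | _ c
  rw [Cu.mk_add_mk, Cu.mk_add_mk, Cu.mk_add_mk, Cu.mk_add_mk, Cu.mk_eq_mk]
  have h := emb_assocEmb_dsum a.val b.val c.val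
  constructor
  · have := emb_cuntzLE assocEmb (dsum (dsum a.val b.val) c.val)
    rwa [h] at this
  · have := cuntzLE_emb assocEmb (dsum (dsum a.val b.val) c.val)
    rwa [h] at this

instance : AddCommMonoid (Cu A) where
  add_assoc := Cu.add_assoc'
  zero_add x := (Cu.add_comm' 0 x).trans (Cu.add_zero' x)
  add_zero := Cu.add_zero'
  add_comm := Cu.add_comm'
  nsmul := nsmulRec

variable (A) in
/-- The projection `1 ⊗ e` in `A ⊗ 𝒦`, where `e` is the rank one projection onto the first basis
vector of `ℓ²(ℕ)`. -/
def unitMat : FinMat A :=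
  FinMat.mk (fun i j => if i = 0 ∧ j = 0 then 1 else 0) ⟨1, fun i j h => if_neg (by omega)⟩

theorem unitMat_apply (i j : ℕ) : unitMat A i j = if i = 0 ∧ j = 0 then 1 else 0 := rfl

theorem unitMat_eq : unitMat A = star (unitMat A) * unitMat A := by
  ext i j
  have hb : FinMat.Bdd 1 (unitMat A) := fun i j h => if_neg (by omega)
  rw [FinMat.mul_apply_right _ hb, Finset.sum_range_one, FinMat.star_apply]
  simp only [unitMat_apply]
  by_cases hi : i = 0 <;> by_cases hj : j = 0 <;> simp [hi, hj]

variable (A) in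
/-- The class `⟨1_A⟩` of the unit of `A`, where `A` is regarded as the corner `A ⊗ e` of
`A ⊗ 𝒦`. -/
def Cu.unit : Cu A := Cu.mk ⟨Stab.of (unitMat A), Stab.of (unitMat A), by
  rw [← Stab.of_star, ← Stab.of_mul, ← unitMat_eq]⟩

end CuntzSemigroup
section TensorOfClasses

open Finset

variable {A : Type u} {B : Type v} [CStarAlgebra A] [CStarAlgebra B]

theorem MinTensor.zero_tmul (b : B) : tmul (0 : A) b = 0 := by
  have h := MinTensor.smul_tmul (0 : ℂ) (0 : A) b
  rwa [zero_smul, zero_smul] at h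

theorem MinTensor.tmul_zero (a : A) : tmul a (0 : B) = 0 := by
  have h := MinTensor.tmul_smul (0 : ℂ) a (0 : B)
  rwa [zero_smul, zero_smul] at h

/-- The elementary tensor as a bilinear map. -/
def MinTensor.tmulₗ : A →ₗ[ℂ] B →ₗ[ℂ] MinTensor A B :=
  LinearMap.mk₂ ℂ MinTensor.tmul MinTensor.add_tmul MinTensor.smul_tmul MinTensor.tmul_add
    MinTensor.tmul_smul

theorem MinTensor.sum_tmul_sum {ι κ : Type*} (s : Finset ι) (t : Finset κ) (f : ι → A)
    (g : κ → B) : tmul (∑ i ∈ s, f i) (∑ k ∈ t, g k) = ∑ i ∈ s, ∑ k ∈ t, tmul (f i) (g k) := by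
  show tmulₗ (∑ i ∈ s, f i) (∑ k ∈ t, g k) = _
  have h : tmulₗ (∑ i ∈ s, f i) = ∑ i ∈ s, (tmulₗ (f i) : B →ₗ[ℂ] MinTensor A B) :=
    map_sum _ _ _
  rw [h, LinearMap.sum_apply]
  refine sum_congr rfl fun i _ => ?_
  exact map_sum _ _ _

namespace FinMat

theorem tensor_bdd {n : ℕ} {M : FinMat A} {N : FinMat B} (hM : Bdd n M) (hN : Bdd n N) (p q : ℕ)
    (h : n ^ 2 ≤ p ∨ n ^ 2 ≤ q) : MinTensor.tmul (M p.unpair.1 q.unpair.1)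
      (N p.unpair.2 q.unpair.2) = 0 := by
  have key : ∀ r : ℕ, n ^ 2 ≤ r → n ≤ r.unpair.1 ∨ n ≤ r.unpair.2 := by
    intro r hr
    by_contra hc
    push Not at hc
    have h1 := Nat.pair_lt_max_add_one_sq r.unpair.1 r.unpair.2
    rw [Nat.pair_unpair] at h1
    have h2 : max r.unpair.1 r.unpair.2 + 1 ≤ n := by omega
    have h3 := Nat.pow_le_pow_left h2 2
    omega
  rcases h with h | h
  · rcases key p h with h1 | h1
    · rw [hM _ _ (Or.inl h1), MinTensor.zero_tmul]
    · rw [hN _ _ (Or.inl h1), MinTensor.tmul_zero]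
  · rcases key q h with h1 | h1
    · rw [hM _ _ (Or.inr h1), MinTensor.zero_tmul]
    · rw [hN _ _ (Or.inr h1), MinTensor.tmul_zero]

/-- The tensor product of two matrices, with entry `M i j ⊗ N k l` at position
`((i, k), (j, l))`, where `ℕ × ℕ` is identified with `ℕ` by the pairing function. -/
def tensor (M : FinMat A) (N : FinMat B) : FinMat (MinTensor A B) :=
  mk (fun p q => MinTensor.tmul (M p.unpair.1 q.unpair.1) (N p.unpair.2 q.unpair.2)) <| by
    obtain ⟨m, hM⟩ := exists_bdd M
    obtain ⟨n, hN⟩ := exists_bdd N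
    exact ⟨(max m n) ^ 2, tensor_bdd (hM.mono (le_max_left m n)) (hN.mono (le_max_right m n))⟩

theorem tensor_apply (M : FinMat A) (N : FinMat B) (p q : ℕ) :
    tensor M N p q = MinTensor.tmul (M p.unpair.1 q.unpair.1) (N p.unpair.2 q.unpair.2) := rfl

theorem tensor_mul (M M' : FinMat A) (N N' : FinMat B) :
    tensor M N * tensor M' N' = tensor (M * M') (N * N') := by
  obtain ⟨m, hM⟩ := exists_bdd M
  obtain ⟨n, hN⟩ := exists_bdd N
  replace hM := hM.mono (le_max_left m n)
  replace hN := hN.mono (le_max_right m n)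
  set k := max m n
  have hb : Bdd (k ^ 2) (tensor M N) := tensor_bdd hM hN
  ext p r
  rw [mul_apply_left hb, tensor_apply, mul_apply_left hM, mul_apply_left hN,
    MinTensor.sum_tmul_sum, ← sum_product']
  symm
  have hsub : (range k ×ˢ range k).map Nat.pairEquiv.toEmbedding ⊆ range (k ^ 2) := by
    intro q hq
    obtain ⟨⟨i, j⟩, hij, rfl⟩ := mem_map.1 hq
    rw [mem_product, mem_range, mem_range] at hij
    rw [mem_range]
    have h1 := Nat.pair_lt_max_add_one_sq i j
    have h2 : max i j + 1 ≤ k := by omega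
    exact h1.trans_le (Nat.pow_le_pow_left h2 2)
  rw [← sum_subset hsub, sum_map]
  · refine sum_congr rfl fun x _ => ?_
    simp only [Equiv.coe_toEmbedding, Nat.pairEquiv_apply, tensor_apply, MinTensor.tmul_mul_tmul,
      Function.uncurry_def, Nat.unpair_pair]
  · intro q _ hq
    have hq' : k ≤ q.unpair.1 ∨ k ≤ q.unpair.2 := by
      by_contra hc
      push Not at hc
      refine hq (mem_map.2 ⟨q.unpair, ?_, ?_⟩)
      · rw [mem_product, mem_range, mem_range]
        exact hc
      · exact Nat.pair_unpair q
    rw [tensor_apply]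
    rcases hq' with h | h
    · rw [hM _ _ (Or.inr h), MinTensor.zero_tmul, zero_mul]
    · rw [hN _ _ (Or.inr h), MinTensor.tmul_zero, zero_mul]

theorem tensor_star (M : FinMat A) (N : FinMat B) :
    tensor (star M) (star N) = star (tensor M N) := by
  ext p q
  rw [star_apply, tensor_apply, tensor_apply, MinTensor.star_tmul, star_apply, star_apply]

theorem add_tensor (M M' : FinMat A) (N : FinMat B) :
    tensor (M + M') N = tensor M N + tensor M' N := by
  ext p q
  simp only [add_apply, tensor_apply, MinTensor.add_tmul]

theorem tensor_add (M : FinMat A) (N N' : FinMat B) :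
    tensor M (N + N') = tensor M N + tensor M N' := by
  ext p q
  simp only [add_apply, tensor_apply, MinTensor.tmul_add]

theorem smul_tensor (c : ℂ) (M : FinMat A) (N : FinMat B) :
    tensor (c • M) N = c • tensor M N := by
  ext p q
  simp only [smul_apply, tensor_apply, MinTensor.smul_tmul]

theorem tensor_smul (c : ℂ) (M : FinMat A) (N : FinMat B) :
    tensor M (c • N) = c • tensor M N := by
  ext p q
  simp only [smul_apply, tensor_apply, MinTensor.tmul_smul]

theorem norm_tensor_projection_right {P : FinMat B} (h1 : star P = P) (h2 : P * P = P)
    (M : FinMat A) : ‖tensor M P‖ ≤ ‖M‖ := by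
  let θ : FinMat A →⋆ₙₐ[ℂ] FinMat (MinTensor A B) :=
    { toFun := fun M => tensor M P
      map_smul' := fun c M => smul_tensor c M P
      map_zero' := by have := smul_tensor 0 (0 : FinMat A) P; rwa [zero_smul, zero_smul] at this
      map_add' := fun M N => add_tensor M N P
      map_mul' := fun M N => by rw [tensor_mul, h2]
      map_star' := fun M => by rw [← tensor_star, h1] }
  have h := norm_hom_le (Stab.ofHom.comp θ) M
  rw [← Stab.norm_of]
  exact h

theorem norm_tensor_projection_left {P : FinMat A} (h1 : star P = P) (h2 : P * P = P)
    (N : FinMat B) : ‖tensor P N‖ ≤ ‖N‖ := by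
  let θ : FinMat B →⋆ₙₐ[ℂ] FinMat (MinTensor A B) :=
    { toFun := fun N => tensor P N
      map_smul' := fun c N => tensor_smul c P N
      map_zero' := by have := tensor_smul 0 P (0 : FinMat B); rwa [zero_smul, zero_smul] at this
      map_add' := fun M N => tensor_add P M N
      map_mul' := fun M N => by rw [tensor_mul, h2]
      map_star' := fun M => by rw [← tensor_star, h1] }
  have h := norm_hom_le (Stab.ofHom.comp θ) N
  rw [← Stab.norm_of]
  exact h

theorem exists_projection (A : Type u) [CStarAlgebra A] (n : ℕ) : ∃ P : FinMat A, star P = P ∧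
    P * P = P ∧ ∀ M : FinMat A, Bdd n M → P * M = M ∧ M * P = M := by
  let f := Function.Embedding.refl ℕ
  refine ⟨star (shift f n) * shift f n, by rw [star_mul, star_star], ?_, fun M hM =>
    ⟨star_shift_mul_shift_mul f hM, mul_star_shift_mul_shift f hM⟩⟩
  refine star_shift_mul_shift_mul f fun i j h => ?_
  rw [star_shift_mul_shift_apply, if_neg (by omega)]

theorem norm_tensor_le (M : FinMat A) (N : FinMat B) : ‖tensor M N‖ ≤ ‖M‖ * ‖N‖ := by
  obtain ⟨m, hM⟩ := exists_bdd M
  obtain ⟨n, hN⟩ := exists_bdd N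
  obtain ⟨P, hP1, hP2, hP⟩ := exists_projection A m
  obtain ⟨Q, hQ1, hQ2, hQ⟩ := exists_projection B n
  have h : tensor M N = tensor M Q * tensor P N := by
    rw [tensor_mul, (hP M hM).2, (hQ N hN).1]
  rw [h]
  exact (norm_mul_le _ _).trans (mul_le_mul (norm_tensor_projection_right hQ1 hQ2 M)
    (norm_tensor_projection_left hP1 hP2 N) (norm_nonneg _) (norm_nonneg _))

/-- `tensor` as a bilinear map. -/
def tensorₗ : FinMat A →ₗ[ℂ] FinMat B →ₗ[ℂ] Stab (MinTensor A B) :=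
  LinearMap.mk₂ ℂ (fun M N => Stab.of (tensor M N))
    (fun M M' N => by rw [add_tensor, map_add]) (fun c M N => by rw [smul_tensor, map_smul])
    (fun M N N' => by rw [tensor_add, map_add]) (fun c M N => by rw [tensor_smul, map_smul])

end FinMat

namespace Stab

/-- The map `(a, b) ↦ a ⊗ b` from `(A ⊗ 𝒦) × (B ⊗ 𝒦)` to
`(A ⊗ 𝒦) ⊗ (B ⊗ 𝒦) = (A ⊗ B) ⊗ 𝒦`. -/
def tensorL : Stab A →L[ℂ] Stab B →L[ℂ] Stab (MinTensor A B) :=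
  bilinExt (LinearMap.mkContinuous₂ FinMat.tensorₗ 1 fun M N => by
    rw [one_mul]
    exact (norm_of _).trans_le (FinMat.norm_tensor_le M N))

theorem tensorL_of (M : FinMat A) (N : FinMat B) :
    tensorL (of M) (of N) = of (FinMat.tensor M N) :=
  bilinExt_coe (LinearMap.mkContinuous₂ FinMat.tensorₗ 1 fun M N => by
    rw [one_mul]
    exact (norm_of _).trans_le (FinMat.norm_tensor_le M N)) M N

theorem continuous_tensorL :
    Continuous fun z : Stab A × Stab B => (tensorL z.1 z.2 : Stab (MinTensor A B)) :=
  (tensorL (A := A) (B := B)).continuous₂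

theorem tensorL_mul (a a' : Stab A) (b b' : Stab B) :
    tensorL a b * tensorL a' b' = tensorL (a * a') (b * b') := by
  refine induction₂ (p := fun a b => tensorL a b * tensorL a' b' = tensorL (a * a') (b * b')) a b
    (isClosed_eq (continuous_tensorL.mul continuous_const) (continuous_tensorL.comp
      ((continuous_fst.mul continuous_const).prodMk (continuous_snd.mul continuous_const))))
    fun M N => ?_
  refine induction₂ (p := fun a' b' => tensorL (of M) (of N) * tensorL a' b'
      = tensorL (of M * a') (of N * b')) a' b'
    (isClosed_eq (continuous_const.mul continuous_tensorL) (continuous_tensorL.comp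
      ((continuous_const.mul continuous_fst).prodMk (continuous_const.mul continuous_snd))))
    fun M' N' => ?_
  rw [← of_mul, ← of_mul, tensorL_of, tensorL_of, tensorL_of, ← of_mul, FinMat.tensor_mul]

theorem tensorL_star (a : Stab A) (b : Stab B) :
    star (tensorL a b) = tensorL (star a) (star b) := by
  refine induction₂ (p := fun a b => star (tensorL a b) = tensorL (star a) (star b)) a b
    (isClosed_eq (continuous_star'.comp continuous_tensorL) (continuous_tensorL.comp
      ((continuous_star'.comp continuous_fst).prodMk (continuous_star'.comp continuous_snd))))
    fun M N => ?_
  rw [← of_star, ← of_star, tensorL_of, tensorL_of, ← of_star, FinMat.tensor_star]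

end Stab

theorem CuntzLE.tensor {a a' : Stab A} {b b' : Stab B} (ha : CuntzLE a a') (hb : CuntzLE b b') :
    CuntzLE (Stab.tensorL a b) (Stab.tensorL a' b') := by
  intro ε hε
  obtain ⟨δ, hδ, h⟩ := Metric.continuous_iff.1 (Stab.continuous_tensorL (A := A) (B := B)) (a, b)
    ε hε
  obtain ⟨d, hd⟩ := ha δ hδ
  obtain ⟨e, he⟩ := hb δ hδ
  refine ⟨Stab.tensorL d e, ?_⟩
  rw [Stab.tensorL_mul, Stab.tensorL_star, Stab.tensorL_mul, ← dist_eq_norm]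
  refine h (d * a' * star d, e * b' * star e) ?_
  rw [Prod.dist_eq, max_lt_iff, dist_eq_norm, dist_eq_norm]
  exact ⟨hd, he⟩

/-- The tensor product of positive elements. -/
def Pos.tensor (a : Pos A) (b : Pos B) : Pos (MinTensor A B) where
  val := Stab.tensorL a.val b.val
  pos := by
    obtain ⟨c, hc⟩ := a.pos
    obtain ⟨d, hd⟩ := b.pos
    exact ⟨Stab.tensorL c d, by rw [Stab.tensorL_star, Stab.tensorL_mul, hc, hd]⟩

/-- The natural map `Cu(A) × Cu(B) → Cu(A ⊗ B)`, `⟨a⟩ ⊗ ⟨b⟩ = ⟨a ⊗ b⟩`. -/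
def Cu.tensor : Cu A → Cu B → Cu (MinTensor A B) :=
  Quotient.map₂ Pos.tensor fun _ _ h _ _ h' =>
    ⟨CuntzLE.tensor h.1 h'.1, CuntzLE.tensor h.2 h'.2⟩

theorem Cu.mk_tensor_mk (a : Pos A) (b : Pos B) :
    Cu.tensor (Cu.mk a) (Cu.mk b) = Cu.mk (Pos.tensor a b) := rfl

end TensorOfClasses

section Divisibility

/-- The relation `u ≪ v`: whenever `v` is the supremum of an increasing sequence `(vᵢ)`, then
`u ≤ vᵢ` for some `i`. -/
def WayBelow {S : Type u} [PartialOrder S] (u v : S) : Prop :=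
  ∀ w : ℕ → S, Monotone w → IsLUB (Set.range w) v → ∃ i, u ≤ w i

variable {A : Type u} [CStarAlgebra A]

/-- `(m, n)`-divisibility of an element of `Cu(A)`. -/
def Cu.Divisible (m n : ℕ) (u : Cu A) : Prop :=
  ∀ u' : Cu A, WayBelow u' u → ∃ x : Cu A, m • x ≤ u ∧ u' ≤ n • x

/-- `(m, n)`-decomposability of an element of `Cu(A)`. -/
def Cu.Decomposable (m n : ℕ) (u : Cu A) : Prop :=
  ∀ u' : Cu A, WayBelow u' u → ∃ x : Fin m → Cu A, ∑ j, x j ≤ u ∧ ∀ j, u' ≤ n • x j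

/-- Weak `(m, n)`-divisibility of an element of `Cu(A)`. -/
def Cu.WeaklyDivisible (m n : ℕ) (u : Cu A) : Prop :=
  ∀ u' : Cu A, WayBelow u' u → ∃ x : Fin n → Cu A, (∀ j, m • x j ≤ u) ∧ u' ≤ ∑ j, x j

end Divisibility

section AlgebraDivisibility

variable (m n : ℕ) (B : Type v) [CStarAlgebra B]

/-- The unital C*-algebra `B` is `(m, n)`-divisible if `⟨1_B⟩` is. -/
def IsDivisible : Prop := Cu.Divisible m n (Cu.unit B)

/-- The unital C*-algebra `B` is `(m, n)`-decomposable if `⟨1_B⟩` is. -/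
def IsDecomposable : Prop := Cu.Decomposable m n (Cu.unit B)

/-- The unital C*-algebra `B` is weakly `(m, n)`-divisible if `⟨1_B⟩` is. -/
def IsWeaklyDivisible : Prop := Cu.WeaklyDivisible m n (Cu.unit B)

end AlgebraDivisibility

end CuntzDiv

end

namespace CuntzDiv

/-! ### Compatibility of addition and order in the Cuntz semigroup -/

section OrderedMonoid

variable {A : Type u} [CStarAlgebra A]

/-! Two facts carry the theorem. The first is algebraic: `Cu.tensor` is biadditive and monotone in
each variable, so integer factors can be moved across the tensor sign. The second is analytic: the
class `⟨1_B⟩` is compact, that is, `⟨1_B⟩ ≪ ⟨1_B⟩` (`wayBelow_unit`). Hence each divisibility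
property may be used with `u' = u = ⟨1_B⟩`. For (i) this gives `z` with `mz ≤ ⟨1_B⟩ ≤ nz`, and then
`x ⊗ ⟨1⟩ ≤ x ⊗ nz = nx ⊗ z ≤ my ⊗ z = y ⊗ mz ≤ y ⊗ ⟨1⟩`. Parts (ii) and (iii) are the same
computation carried out summand by summand.

Most of the work is compactness. If `⟨p⟩` is the least upper bound of an increasing sequence `⟨a
i⟩`, the order alone does not say that `p` is approximated by conjugates of the `a i`. So some upper
bound is constructed that is a norm limit of elements `d (a i) d*` (`exists_upper_bound`). Leastness
puts `⟨p⟩` below it, so some `d (a i) d*` lies within `1/2` of `p`. A Newton iteration in the corner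
at `p` then gives `p ≾ a i` (`conjLimit_of_norm_sub_projection_le`).

The upper bound arises in two stages. `exists_conj_sequence` replaces the `a i` by a sequence with
exact relations `b k = x k * b (k + 1) * (x k)*`, where the `x k` are finite matrices.
`exists_bound_of_conj_sequence` then forms a limit `c` of conjugates of the `b k` by columns whose
entries are rescaled products of the `x k`, placed in mutually orthogonal copies of the index set.
Compressing `c` to the block `j` recovers `b j` exactly. -/

instance : IsOrderedAddMonoid (Cu A) where
  add_le_add_left x y hxy z := by
    induction x using Cu.ind with | _ a
    induction y using Cu.ind with | _ b
    induction z using Cu.ind with | _ c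
    exact CuntzLE.dsum hxy (CuntzLE.refl c.val)

end OrderedMonoid

/-! ### Biadditivity and monotonicity of the tensor product of classes -/

section TensorAdditive

variable {A : Type u} {B : Type v} [CStarAlgebra A] [CStarAlgebra B]

/-- The embedding of `ℕ ≃ ℕ × ℕ` acting by `f` on the first and by `g` on the second factor. -/
def pairEmb (f g : ℕ ↪ ℕ) : ℕ ↪ ℕ :=
  ⟨fun n => Nat.pair (f n.unpair.1) (g n.unpair.2), fun a b h => by
    obtain ⟨h1, h2⟩ := Nat.pair_eq_pair.1 h
    rw [← Nat.pair_unpair a, ← Nat.pair_unpair b, f.injective h1, g.injective h2]⟩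

theorem pairEmb_apply (f g : ℕ ↪ ℕ) (n : ℕ) :
    pairEmb f g n = Nat.pair (f n.unpair.1) (g n.unpair.2) := rfl

theorem FinMat.tensor_emb_emb (f g : ℕ ↪ ℕ) (M : FinMat A) (N : FinMat B) :
    tensor (emb f M) (emb g N) = emb (pairEmb f g) (tensor M N) := by
  -- An index outside the range of the product map is already missed in one coordinate, so one
  -- tensor factor of the entry vanishes.
  have key : ∀ p : ℕ, (¬ ∃ i, pairEmb f g i = p) →
      (¬ ∃ i, f i = p.unpair.1) ∨ ¬ ∃ i, g i = p.unpair.2 := by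
    intro p hp
    by_contra! hc
    obtain ⟨⟨i, hi⟩, ⟨j, hj⟩⟩ := hc
    exact hp ⟨Nat.pair i j, by simp [pairEmb_apply, hi, hj]⟩
  simp only [emb_eq]
  refine ext_range (pairEmb f g) (fun i k => ?_) (fun p q hp => ?_) (fun p q hq => ?_)
  · rw [embFun_apply, tensor_apply, tensor_apply]
    simp only [pairEmb_apply, Nat.unpair_pair, embFun_apply]
  · rw [embFun_apply_left _ _ q hp, tensor_apply]
    rcases key p hp with h | h
    · rw [embFun_apply_left _ _ _ h, MinTensor.zero_tmul]
    · rw [embFun_apply_left _ _ _ h, MinTensor.tmul_zero]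
  · rw [embFun_apply_right _ _ p hq, tensor_apply]
    rcases key q hq with h | h
    · rw [embFun_apply_right _ _ _ h, MinTensor.zero_tmul]
    · rw [embFun_apply_right _ _ _ h, MinTensor.tmul_zero]

theorem Stab.tensorL_emb_emb (f g : ℕ ↪ ℕ) (a : Stab A) (b : Stab B) :
    tensorL (emb f a) (emb g b) = emb (pairEmb f g) (tensorL a b) := by
  refine induction₂ (p := fun a b => tensorL (emb f a) (emb g b)
      = emb (pairEmb f g) (tensorL a b)) a b
    (isClosed_eq (continuous_tensorL.comp (((continuous_emb f).comp continuous_fst).prodMk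
      ((continuous_emb g).comp continuous_snd))) ((continuous_emb _).comp continuous_tensorL))
    fun M N => ?_
  rw [emb_of, emb_of, tensorL_of, tensorL_of, emb_of, FinMat.tensor_emb_emb]

theorem Stab.emb_refl (a : Stab A) : emb (Function.Embedding.refl ℕ) a = a := by
  refine induction₁ (p := fun a => emb (Function.Embedding.refl ℕ) a = a) a
    (isClosed_eq (continuous_emb _) continuous_id) fun M => ?_
  rw [emb_of]
  congr 1
  ext i j
  exact FinMat.embFun_apply (Function.Embedding.refl ℕ) M i j

/-- The embedding acting on the even numbers by `f` and on the odd numbers by `g`. -/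
def joinEmb (f g : ℕ ↪ ℕ) (h : ∀ i j, f i ≠ g j) : ℕ ↪ ℕ :=
  ⟨fun n => if n % 2 = 0 then f (n / 2) else g (n / 2), fun a b hab => by
    simp only at hab
    split_ifs at hab with h1 h2 h2
    · have := f.injective hab
      omega
    · exact absurd hab (h _ _)
    · exact absurd hab.symm (h _ _)
    · have := g.injective hab
      omega⟩

/-- The even and odd blocks of an orthogonal sum can be moved to any two disjoint sets of indices by
a single isometry. This identifies sums of orthogonal blocks with orthogonal sums up to Cuntz
equivalence. -/
theorem emb_joinEmb_dsum (f g : ℕ ↪ ℕ) (h : ∀ i j, f i ≠ g j) (a b : Stab A) :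
    Stab.emb (joinEmb f g h) (dsum a b) = Stab.emb f a + Stab.emb g b := by
  have h1 : evenEmb.trans (joinEmb f g h) = f := by
    ext n
    change (if 2 * n % 2 = 0 then f (2 * n / 2) else g (2 * n / 2)) = f n
    rw [if_pos (by omega), Nat.mul_div_cancel_left n two_pos]
  have h2 : oddEmb.trans (joinEmb f g h) = g := by
    ext n
    change (if (2 * n + 1) % 2 = 0 then f ((2 * n + 1) / 2) else g ((2 * n + 1) / 2)) = g n
    rw [if_neg (by omega), show (2 * n + 1) / 2 = n by omega]
  simp only [dsum, map_add, Stab.emb_emb, h1, h2]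

/-- Conjugation by an isometry `1 ⊗ s` does not change the Cuntz class, although `1 ⊗ s` need not
lie in `A ⊗ 𝒦`: finite truncations of it implement both comparisons. -/
theorem Cu.mk_eq_mk_of_emb {a b : Pos A} (f : ℕ ↪ ℕ) (h : Stab.emb f a.val = b.val) :
    Cu.mk a = Cu.mk b :=
  Cu.mk_eq_mk.2 ⟨h ▸ emb_cuntzLE f a.val, h ▸ cuntzLE_emb f a.val⟩

/-- Under `ℕ ≃ ℕ × ℕ`, the element `(a ⊕ b) ⊗ c` is the sum of copies of `a ⊗ c` and `b ⊗ c`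
supported on the pairs with even and with odd first coordinate. These index sets are disjoint, so
one isometry carries `(a ⊗ c) ⊕ (b ⊗ c)` onto it. -/
theorem Cu.add_tensor (x y : Cu A) (z : Cu B) : tensor (x + y) z = tensor x z + tensor y z := by
  induction x using Cu.ind with | _ a
  induction y using Cu.ind with | _ b
  induction z using Cu.ind with | _ c
  rw [mk_add_mk, mk_tensor_mk, mk_tensor_mk, mk_tensor_mk, mk_add_mk]
  refine (mk_eq_mk_of_emb (joinEmb (pairEmb evenEmb (Function.Embedding.refl ℕ))
    (pairEmb oddEmb (Function.Embedding.refl ℕ)) fun i j h => ?_) ?_).symm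
  · exact evenEmb_ne_oddEmb _ _ (Nat.pair_eq_pair.1 h).1
  · change Stab.emb _ (dsum (Stab.tensorL a.val c.val) (Stab.tensorL b.val c.val))
      = Stab.tensorL (dsum a.val b.val) c.val
    rw [emb_joinEmb_dsum, ← Stab.tensorL_emb_emb, ← Stab.tensorL_emb_emb, Stab.emb_refl, dsum,
      map_add, _root_.add_apply]

theorem Cu.tensor_add (x : Cu A) (y z : Cu B) : tensor x (y + z) = tensor x y + tensor x z := by
  induction x using Cu.ind with | _ a
  induction y using Cu.ind with | _ b
  induction z using Cu.ind with | _ c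
  rw [mk_add_mk, mk_tensor_mk, mk_tensor_mk, mk_tensor_mk, mk_add_mk]
  refine (mk_eq_mk_of_emb (joinEmb (pairEmb (Function.Embedding.refl ℕ) evenEmb)
    (pairEmb (Function.Embedding.refl ℕ) oddEmb) fun i j h => ?_) ?_).symm
  · exact evenEmb_ne_oddEmb _ _ (Nat.pair_eq_pair.1 h).2
  · change Stab.emb _ (dsum (Stab.tensorL a.val b.val) (Stab.tensorL a.val c.val))
      = Stab.tensorL a.val (dsum b.val c.val)
    rw [emb_joinEmb_dsum, ← Stab.tensorL_emb_emb, ← Stab.tensorL_emb_emb, Stab.emb_refl, dsum,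
      map_add]

theorem Cu.zero_tensor (z : Cu B) : tensor (0 : Cu A) z = 0 := by
  induction z using Cu.ind with | _ c
  refine congrArg Cu.mk ?_
  simp only [Pos.tensor, map_zero, _root_.zero_apply]

theorem Cu.tensor_zero (x : Cu A) : tensor x (0 : Cu B) = 0 := by
  induction x using Cu.ind with | _ a
  refine congrArg Cu.mk ?_
  simp only [Pos.tensor, map_zero]

theorem Cu.tensor_mono {x x' : Cu A} {y y' : Cu B} (hx : x ≤ x') (hy : y ≤ y') :
    tensor x y ≤ tensor x' y' := by
  induction x using Cu.ind with | _ a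
  induction x' using Cu.ind with | _ a'
  induction y using Cu.ind with | _ b
  induction y' using Cu.ind with | _ b'
  exact CuntzLE.tensor hx hy

/-- The tensor product with a fixed class on the right. -/
noncomputable def Cu.tensorRight (z : Cu B) : Cu A →+ Cu (MinTensor A B) where
  toFun x := tensor x z
  map_zero' := zero_tensor z
  map_add' x y := add_tensor x y z

/-- The tensor product with a fixed class on the left. -/
noncomputable def Cu.tensorLeft (x : Cu A) : Cu B →+ Cu (MinTensor A B) where
  toFun := tensor x
  map_zero' := tensor_zero x
  map_add' := tensor_add x

theorem Cu.nsmul_tensor (n : ℕ) (x : Cu A) (z : Cu B) : tensor (n • x) z = n • tensor x z :=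
  map_nsmul (tensorRight z) n x

theorem Cu.tensor_nsmul (n : ℕ) (x : Cu A) (z : Cu B) : tensor x (n • z) = n • tensor x z :=
  map_nsmul (tensorLeft x) n z

theorem Cu.sum_tensor {ι : Type*} (s : Finset ι) (x : ι → Cu A) (z : Cu B) :
    tensor (∑ i ∈ s, x i) z = ∑ i ∈ s, tensor (x i) z :=
  map_sum (tensorRight z) x s

theorem Cu.tensor_sum {ι : Type*} (s : Finset ι) (x : Cu A) (z : ι → Cu B) :
    tensor x (∑ i ∈ s, z i) = ∑ i ∈ s, tensor x (z i) :=
  map_sum (tensorLeft x) z s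

end TensorAdditive

end CuntzDiv

namespace CuntzDiv

/-! ### Limits of conjugates in a C*-algebra -/

section ConjugationLimits

open Filter Topology

variable {D : Type u} [NonUnitalCStarAlgebra D]

variable (D) in
theorem isClosed_setOf_eq_star_mul_self : IsClosed {a : D | ∃ c, a = star c * c} := by
  let _ := CStarAlgebra.spectralOrder D
  have := CStarAlgebra.spectralOrderedRing D
  have h : {a : D | ∃ c, a = star c * c} = {a | 0 ≤ a} := by
    ext a
    exact CStarAlgebra.nonneg_iff_eq_star_mul_self.symm
  rw [h]
  exact CStarAlgebra.isClosed_nonneg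

theorem norm_conj_le (d t : D) : ‖d * t * star d‖ ≤ ‖d‖ ^ 2 * ‖t‖ := by
  calc ‖d * t * star d‖ ≤ ‖d‖ * ‖t‖ * ‖star d‖ :=
        (norm_mul_le _ _).trans (mul_le_mul_of_nonneg_right (norm_mul_le _ _) (norm_nonneg _))
    _ = ‖d‖ ^ 2 * ‖t‖ := by rw [norm_star]; ring

theorem conj_sub (d s t : D) : d * (s - t) * star d = d * s * star d - d * t * star d := by
  rw [mul_sub, sub_mul]

theorem conj_conj (d e t : D) : d * (e * t * star e) * star d = d * e * t * star (d * e) := by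
  simp only [star_mul, mul_assoc]

/-- The element `t` is a limit of elements of the form `d s d*` with `s ∈ S`. -/
def ConjLimit (S : Set D) (t : D) : Prop :=
  ∀ ε : ℝ, 0 < ε → ∃ s ∈ S, ∃ d : D, ‖d * s * star d - t‖ < ε

theorem ConjLimit.trans {S T : Set D} {t : D} (h : ConjLimit S t) (hST : ∀ s ∈ S, ConjLimit T s) :
    ConjLimit T t := by
  intro ε hε
  obtain ⟨s, hs, d, hd⟩ := h (ε / 2) (half_pos hε)
  -- The tolerance is chosen after `d`, because conjugation by `d` enlarges errors by up to `‖d‖ ^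
  -- 2`; the summand `1` covers `d = 0`.
  obtain ⟨r, hr, e, he⟩ := hST s hs (ε / 2 / (‖d‖ ^ 2 + 1)) (by positivity)
  refine ⟨r, hr, d * e, ?_⟩
  have h1 : ‖d * (e * r * star e - s) * star d‖ ≤ ε / 2 := by
    calc ‖d * (e * r * star e - s) * star d‖ ≤ ‖d‖ ^ 2 * ‖e * r * star e - s‖ := norm_conj_le _ _
      _ ≤ (‖d‖ ^ 2 + 1) * (ε / 2 / (‖d‖ ^ 2 + 1)) := by
          gcongr
          linarith
      _ = ε / 2 := by field_simp
  rw [conj_sub, conj_conj] at h1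
  linarith [norm_sub_le_norm_sub_add_norm_sub (d * e * r * star (d * e)) (d * s * star d) t]

/-- Positivity survives conjugation and norm limits, the positive cone being closed. This makes the
constructed upper bound a positive element. -/
theorem ConjLimit.exists_eq_star_mul_self {S : Set D} {t : D} (h : ConjLimit S t)
    (hS : ∀ s ∈ S, ∃ c, s = star c * c) : ∃ c, t = star c * c := by
  refine (isClosed_setOf_eq_star_mul_self D).closure_subset (Metric.mem_closure_iff.2 fun ε hε => ?_)
  obtain ⟨s, hs, d, hd⟩ := h ε hε
  obtain ⟨c, rfl⟩ := hS s hs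
  refine ⟨d * (star c * c) * star d, ⟨c * star d, ?_⟩, ?_⟩
  · simp only [star_mul, star_star, mul_assoc]
  · rwa [dist_comm, dist_eq_norm]

theorem norm_projection_le_one {p : D} (hp : star p = p) (hpp : p * p = p) : ‖p‖ ≤ 1 := by
  have h : ‖star p * p‖ = ‖p‖ * ‖p‖ := CStarRing.norm_star_mul_self
  rw [hp, hpp] at h
  by_contra! hc
  nlinarith

/-- A projection `p` that is close to `d a d*` is a limit of elements `e a e*`. -/
theorem conjLimit_of_norm_sub_projection_le {p a d : D} (hp : star p = p) (hpp : p * p = p)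
    (ha : star a = a) (hd : ‖d * a * star d - p‖ ≤ 1 / 2) : ConjLimit {a} p := by
  -- Newton iteration for the inverse square root in the corner with unit `p`; the condition `p * e
  -- = e` keeps `e * a * star e` in that corner.
  have key : ∀ n : ℕ, ∃ e, p * e = e ∧ ‖e * a * star e - p‖ ≤ (1 / 2) ^ (n + 1) := by
    intro n
    induction n with
    | zero =>
      refine ⟨p * d, by rw [← mul_assoc, hpp], ?_⟩
      have h1 : p * d * a * star (p * d) - p = p * (d * a * star d - p) * star p := by
        rw [conj_sub, conj_conj, hp, hpp, hpp]
      have h2 := norm_projection_le_one hp hpp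
      rw [h1]
      calc ‖p * (d * a * star d - p) * star p‖ ≤ ‖p‖ ^ 2 * ‖d * a * star d - p‖ := norm_conj_le _ _
        _ ≤ 1 ^ 2 * (1 / 2) := by gcongr
        _ = (1 / 2) ^ (0 + 1) := by norm_num
    | succ n ih =>
      obtain ⟨e, he, hn⟩ := ih
      -- With `e a e* = p - 2s`, the inverse square root is `p + s` to first order, and `(p + s)(p -
      -- 2s)(p + s) = p - 3s² - 2s³`: the linear term cancels.
      set s : D := (1 / 2 : ℂ) • (p - e * a * star e) with hs
      have hss : e * a * star e = p - (s + s) := by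
        rw [hs, ← add_smul]
        norm_num
      have he' : star e * p = star e := by
        have := congrArg star he
        rwa [star_mul, hp] at this
      have hps : p * s = s := by
        rw [hs, mul_smul_comm, mul_sub, hpp, ← mul_assoc, ← mul_assoc, he]
      have hsp : s * p = s := by
        rw [hs, smul_mul_assoc, sub_mul, hpp, mul_assoc, he']
      have hssp : s * s * p = s * s := by rw [mul_assoc, hsp]
      have hstar : star s = s := by
        rw [hs, star_smul, star_sub, hp, star_mul, star_mul, star_star, ha, ← mul_assoc]
        simp
      have hnorm : ‖s‖ ≤ (1 / 2) ^ (n + 2) := by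
        rw [hs, norm_smul, norm_sub_rev, pow_succ']
        have : ‖(1 / 2 : ℂ)‖ = 1 / 2 := by norm_num
        rw [this]
        gcongr
      refine ⟨(p + s) * e, by rw [← mul_assoc, mul_add, hpp, hps], ?_⟩
      have h1 : (p + s) * e * a * star ((p + s) * e) - p
          = -(s * s + s * s + s * s + (s * s * s + s * s * s)) := by
        rw [← conj_conj, hss, star_add, hp, hstar]
        simp only [add_mul, mul_add, mul_sub, sub_mul, hpp, hps, hsp, hssp]
        abel
      have h2 : ‖s * s‖ ≤ ‖s‖ * ‖s‖ := norm_mul_le _ _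
      have h3 : ‖s * s * s‖ ≤ ‖s‖ * ‖s‖ * ‖s‖ :=
        (norm_mul_le _ _).trans (mul_le_mul_of_nonneg_right h2 (norm_nonneg _))
      have h4 : ‖s * s + s * s + s * s + (s * s * s + s * s * s)‖
          ≤ ‖s * s‖ + ‖s * s‖ + ‖s * s‖ + (‖s * s * s‖ + ‖s * s * s‖) := by
        refine (norm_add_le _ _).trans (add_le_add ?_ (norm_add_le _ _))
        exact (norm_add_le _ _).trans (add_le_add_left (norm_add_le _ _) _)
      -- This gives `3‖s‖² + 2‖s‖³ ≤ (7/8)‖s‖`, so the new error is at most `‖s‖`, which is half the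
      -- old one.
      have h5 : ‖s‖ ≤ 1 / 4 := by
        refine hnorm.trans ?_
        calc (1 / 2 : ℝ) ^ (n + 2) ≤ (1 / 2) ^ 2 :=
              pow_le_pow_of_le_one (by norm_num) (by norm_num) (by omega)
          _ = 1 / 4 := by norm_num
      have h6 : ‖s‖ * ‖s‖ ≤ 1 / 4 * ‖s‖ := mul_le_mul_of_nonneg_right h5 (norm_nonneg _)
      have h7 : ‖s‖ * ‖s‖ * ‖s‖ ≤ 1 / 4 * ‖s‖ * ‖s‖ := mul_le_mul_of_nonneg_right h6 (norm_nonneg _)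
      rw [h1, norm_neg]
      have h8 := norm_nonneg s
      change _ ≤ (1 / 2 : ℝ) ^ (n + 2)
      linarith
  intro ε hε
  obtain ⟨n, hn⟩ := exists_pow_lt_of_lt_one hε (by norm_num : (1 / 2 : ℝ) < 1)
  obtain ⟨e, -, he⟩ := key n
  refine ⟨a, rfl, e, he.trans_lt (lt_of_le_of_lt ?_ hn)⟩
  exact pow_le_pow_of_le_one (by norm_num) (by norm_num) (by omega)

theorem tendsto_conj {u : ℕ → D} {t : D} (d : D) (h : Tendsto u atTop (𝓝 t)) :
    Tendsto (fun n => d * u n * star d) atTop (𝓝 (d * t * star d)) :=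
  (h.const_mul d).mul_const (star d)

/-- An increasing sequence for Cuntz subequivalence is equivalent to a sequence `b` in which
every term is exactly of the form `x b x*` for the next term `b`. -/
theorem exists_conj_sequence {S : Set D} {a : ℕ → D}
    (h : ∀ i j, i ≤ j → ∀ ε : ℝ, 0 < ε → ∃ d ∈ S, ‖d * a j * star d - a i‖ < ε) :
    ∃ x b : ℕ → D, (∀ k, x k ∈ S) ∧ (∀ k, b k = x k * b (k + 1) * star (x k)) ∧
      (∀ i, ConjLimit (Set.range b) (a i)) ∧ ∀ j, ConjLimit (Set.range a) (b j) := by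
  -- The `e i j` compare all pairs and serve only to recover `a i` from `b j`. The `X k ε` compare
  -- neighbours at a tolerance still to be fixed, and become the `x k`.
  choose! e heS he using fun i j (hij : i ≤ j) =>
    h i j hij ((1 / 2) ^ j) (by positivity)
  choose X hXS hX using fun k (ε : {ε : ℝ // 0 < ε}) =>
    h k (k + 1) k.le_succ ε.1 ε.2
  let E : ℕ → ℝ := fun j => ∑ i ∈ Finset.range (j + 1), ‖e i j‖ ^ 2
  have hE : ∀ j, 0 ≤ E j := fun j => Finset.sum_nonneg fun i _ => by positivity
  let δ : ℕ → {q : ℝ // 0 < q} → {ε : ℝ // 0 < ε} := fun k q =>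
    ⟨(1 / 2) ^ k / q.1, div_pos (by positivity) q.2⟩
  -- The weights `Q k` measure how much later conjugations may magnify an error at place `k`. `Q k`
  -- fixes the tolerance `2⁻ᵏ / Q k` for `x k`, and only then does `‖x k‖` enter `Q (k + 1)`, so the
  -- choice is not circular. The recursion ensures `Q (k + 1) ≥ Q k * ‖x k‖ ^ 2` and `Q k ≥ E k`.
  let Q : ℕ → {q : ℝ // 0 < q} := fun k => Nat.rec ⟨1 + E 0, by linarith [hE 0]⟩
    (fun k q => ⟨q.1 * (1 + ‖X k (δ k q)‖ ^ 2) + E (k + 1),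
      add_pos_of_pos_of_nonneg (mul_pos q.2 (by positivity)) (hE _)⟩) k
  let x : ℕ → D := fun k => X k (δ k (Q k))
  have hQs : ∀ k, (Q (k + 1)).1 = (Q k).1 * (1 + ‖x k‖ ^ 2) + E (k + 1) := fun k => rfl
  have hQ1 : ∀ k, (Q k).1 * ‖x k‖ ^ 2 ≤ (Q (k + 1)).1 := fun k => by
    rw [hQs]
    linarith [(Q k).2, hE (k + 1)]
  have hQE : ∀ k, E k ≤ (Q k).1 := by
    rintro (_ | k)
    · change E 0 ≤ 1 + E 0
      linarith
    · rw [hQs]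
      have := mul_pos (Q k).2 (show 0 < 1 + ‖x k‖ ^ 2 by positivity)
      linarith
  -- Here `u n j` is the conjugate of `a (j + n)` by `x j ⋯ x (j + n - 1)`; its limit in `n` is `b
  -- j`.
  let u : ℕ → ℕ → D := fun n => Nat.rec a (fun _ v j => x j * v (j + 1) * star (x j)) n
  have hu0 : ∀ j, u 0 j = a j := fun j => rfl
  have hus : ∀ n j, u (n + 1) j = x j * u n (j + 1) * star (x j) := fun n j => rfl
  have hstep : ∀ n j, (Q j).1 * ‖u (n + 1) j - u n j‖ ≤ (1 / 2) ^ (j + n) := by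
    intro n
    induction n with
    | zero =>
      intro j
      have h1 : ‖x j * a (j + 1) * star (x j) - a j‖ < (1 / 2) ^ j / (Q j).1 :=
        hX j (δ j (Q j))
      rw [lt_div_iff₀ (Q j).2] at h1
      rw [hus, hu0, hu0, mul_comm]
      exact h1.le
    | succ n ih =>
      intro j
      rw [hus (n + 1), hus n, ← conj_sub]
      calc (Q j).1 * ‖x j * (u (n + 1) (j + 1) - u n (j + 1)) * star (x j)‖
          ≤ (Q j).1 * (‖x j‖ ^ 2 * ‖u (n + 1) (j + 1) - u n (j + 1)‖) :=
            mul_le_mul_of_nonneg_left (norm_conj_le _ _) (Q j).2.le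
        _ = (Q j).1 * ‖x j‖ ^ 2 * ‖u (n + 1) (j + 1) - u n (j + 1)‖ := by ring
        _ ≤ (Q (j + 1)).1 * ‖u (n + 1) (j + 1) - u n (j + 1)‖ :=
            mul_le_mul_of_nonneg_right (hQ1 j) (norm_nonneg _)
        _ ≤ (1 / 2) ^ (j + 1 + n) := ih (j + 1)
        _ = (1 / 2) ^ (j + (n + 1)) := by congr 1; omega
  have hgeom : ∀ j n, dist (u n j) (u (n + 1) j) ≤ (1 / 2) ^ j / (Q j).1 * (1 / 2) ^ n := by
    intro j n
    rw [dist_comm, dist_eq_norm, div_mul_eq_mul_div, le_div_iff₀ (Q j).2, ← pow_add, mul_comm]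
    exact hstep n j
  choose b hb using fun j => cauchySeq_tendsto_of_complete
    (cauchySeq_of_le_geometric _ _ (by norm_num) (hgeom j))
  have hab : ∀ j, (Q j).1 * ‖b j - a j‖ ≤ 2 * (1 / 2) ^ j := by
    intro j
    have h1 := dist_le_of_le_geometric_of_tendsto₀ _ _ (by norm_num) (hgeom j) (hb j)
    rw [hu0, dist_comm, dist_eq_norm] at h1
    calc (Q j).1 * ‖b j - a j‖ ≤ (Q j).1 * ((1 / 2) ^ j / (Q j).1 / (1 - 1 / 2)) :=
          mul_le_mul_of_nonneg_left h1 (Q j).2.le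
      _ = 2 * (1 / 2) ^ j := by
          have := (Q j).2.ne'
          field_simp
          norm_num
  refine ⟨x, b, fun k => hXS _ _, fun k => ?_, fun i ε hε => ?_, fun j ε hε => ?_⟩
  -- The exact relation is the limit of `u (n + 1) k = x k * u n (k + 1) * star (x k)`.
  · exact tendsto_nhds_unique ((tendsto_add_atTop_iff_nat 1).2 (hb k))
      (tendsto_conj (x k) (hb (k + 1)))
  -- Two of the three units of `2⁻ʲ` come from replacing `a j` by `b j`, where `Q j ≥ E j ≥ ‖e i j‖
  -- ^ 2`, and one from the choice of `e i j`.
  · obtain ⟨n, hn⟩ := exists_pow_lt_of_lt_one (show 0 < ε / 3 by positivity)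
      (by norm_num : (1 / 2 : ℝ) < 1)
    let j := max i n
    refine ⟨b j, ⟨j, rfl⟩, e i j, ?_⟩
    have h1 : ‖e i j * (b j - a j) * star (e i j)‖ ≤ 2 * (1 / 2) ^ j := by
      refine (norm_conj_le _ _).trans (le_trans ?_ (hab j))
      refine mul_le_mul_of_nonneg_right (le_trans ?_ (hQE j)) (norm_nonneg _)
      exact Finset.single_le_sum (f := fun i => ‖e i j‖ ^ 2) (fun _ _ => by positivity)
        (Finset.mem_range.2 (by omega))
    have h2 := he i j (le_max_left i n)
    have h3 : (1 / 2 : ℝ) ^ j ≤ (1 / 2) ^ n :=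
      pow_le_pow_of_le_one (by norm_num) (by norm_num) (le_max_right i n)
    rw [conj_sub] at h1
    linarith [norm_sub_le_norm_sub_add_norm_sub (e i j * b j * star (e i j))
      (e i j * a j * star (e i j)) (a i)]
  · have hprod : ∀ n j, ∃ d, u (n + 1) j = d * a (j + n + 1) * star d := by
      intro n
      induction n with
      | zero => exact fun j => ⟨x j, rfl⟩
      | succ n ih =>
        intro j
        obtain ⟨d, hd⟩ := ih (j + 1)
        refine ⟨x j * d, ?_⟩
        rw [hus (n + 1) j, hd, conj_conj, show j + 1 + n + 1 = j + (n + 1) + 1 by omega]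
    obtain ⟨n, hn⟩ := (Metric.tendsto_atTop.1 ((tendsto_add_atTop_iff_nat 1).2 (hb j)) ε hε)
    obtain ⟨d, hd⟩ := hprod n j
    refine ⟨a (j + n + 1), ⟨_, rfl⟩, d, ?_⟩
    rw [← hd, ← dist_eq_norm]
    exact hn n le_rfl

/-- A sequence with `b k = x k * b (k + 1) * (x k)*` has an upper bound for Cuntz subequivalence
that is a limit of elements subequivalent to its terms. -/
theorem exists_bound_of_conj_sequence {x b s : ℕ → D}
    (hb : ∀ k, b k = x k * b (k + 1) * star (x k)) (hs : ∀ k, ‖s k‖ ≤ 1)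
    (hsx : ∀ k, star (s k) * s k * x k = x k) (hss : ∀ i j, i ≠ j → star (s i) * s j = 0) :
    ∃ c, (∀ k, ∃ d, d * c * star d = b k) ∧ ConjLimit (Set.range b) c := by
  -- With `‖T‖ ≤ l k v ≤ 1`, the change from `v b v*` to `(v + T) b (v + T)*`, where `b = b k`, is
  -- at most `l k v * (2‖v‖ + 1) * ‖b‖ ≤ 2⁻ᵏ`.
  let l : ℕ → D → ℝ := fun k v => (1 / 2) ^ k / ((2 * ‖v‖ + 1) * (‖b k‖ + 1))
  have hlpos : ∀ k v, 0 < l k v := fun k v => by positivity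
  have hl1 : ∀ k v, l k v ≤ 1 := fun k v => by
    refine div_le_one_of_le₀ ?_ (by positivity)
    calc (1 / 2 : ℝ) ^ k ≤ 1 := pow_le_one₀ (by norm_num) (by norm_num)
      _ ≤ (2 * ‖v‖ + 1) * (‖b k‖ + 1) :=
          one_le_mul_of_one_le_of_one_le (by linarith [norm_nonneg v])
            (by linarith [norm_nonneg (b k)])
  -- Unwound, `V k` is the sum over `j < k` of `r j • s j * x j ⋯ x (k - 1)`: a column whose entries
  -- sit in the orthogonal ranges of the `s j`.
  let V : ℕ → D := fun k => Nat.rec 0 (fun k v => (v + (l k v : ℂ) • s k) * x k) k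
  let r : ℕ → ℝ := fun k => l k (V k)
  have hVs : ∀ k, V (k + 1) = (V k + (r k : ℂ) • s k) * x k := fun k => rfl
  let W : ℕ → D := fun k => V k * b k * star (V k)
  have hstep : ∀ k, dist (W k) (W (k + 1)) ≤ 1 * (1 / 2) ^ k := by
    intro k
    set T : D := (r k : ℂ) • s k with hT
    have hTn : ‖T‖ ≤ r k := by
      rw [hT, norm_smul, Complex.norm_real, Real.norm_of_nonneg (hlpos _ _).le]
      exact mul_le_of_le_one_right (hlpos _ _).le (hs k)
    have h1 : W (k + 1) - W k
        = T * b k * star (V k) + V k * b k * star T + T * b k * star T := by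
      -- The relation `x k * b (k + 1) * star (x k) = b k` absorbs the factor `x k`, so `W` changes
      -- only through the small new entry `T`.
      have : W (k + 1) = (V k + T) * b k * star (V k + T) := by
        simp only [W]
        rw [hVs, ← conj_conj, ← hb]
      rw [this]
      simp only [W, star_add, add_mul, mul_add]
      abel
    have hr : r k * ((2 * ‖V k‖ + 1) * (‖b k‖ + 1)) = (1 / 2) ^ k :=
      div_mul_cancel₀ _ (by positivity)
    have h3 : ∀ y z : D, ‖y * b k * star z‖ ≤ ‖y‖ * ‖b k‖ * ‖z‖ := fun y z => by
      rw [← norm_star z]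
      exact (norm_mul_le _ _).trans (mul_le_mul_of_nonneg_right (norm_mul_le _ _) (norm_nonneg _))
    rw [dist_comm, dist_eq_norm, h1, one_mul, ← hr]
    calc ‖T * b k * star (V k) + V k * b k * star T + T * b k * star T‖
        ≤ ‖T‖ * ‖b k‖ * ‖V k‖ + ‖V k‖ * ‖b k‖ * ‖T‖ + ‖T‖ * ‖b k‖ * ‖T‖ :=
          norm_add₃_le.trans (add_le_add (add_le_add (h3 _ _) (h3 _ _)) (h3 _ _))
      _ ≤ r k * ‖b k‖ * ‖V k‖ + ‖V k‖ * ‖b k‖ * r k + r k * ‖b k‖ * 1 := by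
          have := hTn.trans (hl1 k (V k))
          have := (hlpos k (V k)).le
          gcongr
      _ = r k * ((2 * ‖V k‖ + 1) * ‖b k‖) := by ring
      _ ≤ r k * ((2 * ‖V k‖ + 1) * (‖b k‖ + 1)) := by
          have := (hlpos k (V k)).le
          gcongr
          linarith
  obtain ⟨c, hc⟩ := cauchySeq_tendsto_of_complete
    (cauchySeq_of_le_geometric _ _ (by norm_num) hstep)
  have hzero : ∀ j k, k ≤ j → star (s j) * V k = 0 := by
    intro j k
    induction k with
    | zero => exact fun _ => mul_zero _
    | succ k ih =>
      intro hk
      rw [hVs, ← mul_assoc, mul_add, ih (by omega), mul_smul_comm, hss j k (by omega), smul_zero,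
        add_zero, zero_mul]
  -- Multiplying by `star (s j)` picks out the entry `j` of the column, with `y = x j ⋯ x (j + n)`;
  -- the exact relations carry `b (j + 1 + n)` back to `b j`.
  have hrow : ∀ j n, ∃ y, star (s j) * V (j + 1 + n) = (r j : ℂ) • y ∧
      y * b (j + 1 + n) * star y = b j := by
    intro j n
    induction n with
    | zero =>
      refine ⟨x j, ?_, (hb j).symm⟩
      rw [add_zero, hVs, ← mul_assoc, mul_add, hzero j j le_rfl, zero_add, mul_smul_comm,
        smul_mul_assoc, hsx]
    | succ n ih =>
      obtain ⟨y, hy, hy'⟩ := ih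
      refine ⟨y * x (j + 1 + n), ?_, ?_⟩
      · rw [← add_assoc, hVs, ← mul_assoc, mul_add, hy, mul_smul_comm, hss j _ (by omega),
          smul_zero, add_zero, smul_mul_assoc]
      · rw [← add_assoc, ← conj_conj, ← hb, hy']
  -- Conjugating `W k` by this element gives `b j` for every `k ≥ j + 1`, hence also in the limit.
  refine ⟨c, fun j => ⟨((r j)⁻¹ : ℂ) • star (s j), ?_⟩, fun ε hε => ?_⟩
  · have hr : (r j : ℂ) ≠ 0 := Complex.ofReal_ne_zero.2 (hlpos _ _).ne'
    have h1 := (tendsto_add_atTop_iff_nat (j + 1)).2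
      (tendsto_conj (((r j)⁻¹ : ℂ) • star (s j)) hc)
    refine tendsto_nhds_unique h1 (tendsto_const_nhds.congr fun n => ?_)
    obtain ⟨y, hy, hy'⟩ := hrow j n
    rw [add_comm n]
    simp only [W]
    rw [conj_conj, smul_mul_assoc, hy, smul_smul, inv_mul_cancel₀ hr, one_smul, hy']
  · obtain ⟨k, hk⟩ := Metric.tendsto_atTop.1 hc ε hε
    refine ⟨b k, ⟨k, rfl⟩, V k, ?_⟩
    rw [← dist_eq_norm]
    exact hk k le_rfl

end ConjugationLimits

/-! ### Upper bounds of increasing sequences and compactness of the unit class -/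

section IncreasingSequences

variable {A : Type u} [CStarAlgebra A]

theorem CuntzLE.conjLimit {a b : Stab A} (h : CuntzLE a b) : ConjLimit {b} a := fun ε hε =>
  ⟨b, rfl, h ε hε⟩

theorem ConjLimit.cuntzLE {a b : Stab A} (h : ConjLimit {b} a) : CuntzLE a b := fun ε hε => by
  obtain ⟨_, rfl, hd⟩ := h ε hε
  exact hd

/-- The admissible `d` form an open set and `M_∞(A)` is dense. Finite matrices are wanted because
they leave room for the partial isometries of `exists_partial_isometries`. -/
theorem CuntzLE.exists_of {a b : Stab A} (h : CuntzLE a b) (ε : ℝ) (hε : 0 < ε) :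
    ∃ d ∈ Set.range (Stab.of : FinMat A → Stab A), ‖d * b * star d - a‖ < ε := by
  have ho : IsOpen {d : Stab A | ‖d * b * star d - a‖ < ε} :=
    isOpen_lt (((continuous_id.mul continuous_const).mul Stab.continuous_star').sub
      continuous_const).norm continuous_const
  obtain ⟨M, hM⟩ := Stab.denseRange_of.exists_mem_open ho (h ε hε)
  exact ⟨Stab.of M, ⟨M, rfl⟩, hM⟩

theorem FinMat.star_shift_mul_shift_eq_zero {f g : ℕ ↪ ℕ} (hfg : ∀ i j, f i ≠ g j) (m n : ℕ) :
    star (shift f m) * shift g n = (0 : FinMat A) := by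
  obtain ⟨K, hK⟩ := exists_bdd (star (shift f m) : FinMat A)
  ext i j
  rw [mul_apply_left hK]
  refine Finset.sum_eq_zero fun r _ => ?_
  rw [star_apply, shift_apply, shift_apply]
  by_cases h : r = f i ∧ i < m
  · rw [if_neg fun h' : r = g j ∧ j < n => hfg i j (h.1.symm.trans h'.1), mul_zero]
  · rw [if_neg h, star_zero, zero_mul]

/-- The embedding of `ℕ` as the row `k` of `ℕ × ℕ ≃ ℕ`. -/
def rowEmb (k : ℕ) : ℕ ↪ ℕ := ⟨Nat.pair k, fun _ _ h => (Nat.pair_eq_pair.1 h).2⟩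

/-- If `x k` vanishes outside the `n × n` corner, let `s k` copy the first `n` basis vectors into
row `k` of `ℕ × ℕ ≃ ℕ`. Its initial projection then fixes `x k`, and distinct rows are disjoint. -/
theorem exists_partial_isometries {x : ℕ → Stab A}
    (hx : ∀ k, x k ∈ Set.range (Stab.of : FinMat A → Stab A)) :
    ∃ s : ℕ → Stab A, (∀ k, ‖s k‖ ≤ 1) ∧ (∀ k, star (s k) * s k * x k = x k) ∧
      ∀ i j, i ≠ j → star (s i) * s j = 0 := by
  choose M hM using hx
  choose n hn using fun k => FinMat.exists_bdd (M k)
  refine ⟨fun k => Stab.of (FinMat.shift (rowEmb k) (n k)), fun k => ?_, fun k => ?_,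
    fun i j hij => ?_⟩
  · rw [Stab.norm_of]
    exact FinMat.norm_shift_le _ _
  · rw [← hM, ← Stab.of_star, ← Stab.of_mul, ← Stab.of_mul,
      FinMat.star_shift_mul_shift_mul _ (hn k)]
  · rw [← Stab.of_star, ← Stab.of_mul, FinMat.star_shift_mul_shift_eq_zero, map_zero]
    exact fun p q h => hij (Nat.pair_eq_pair.1 h).1

/-- An increasing sequence in the Cuntz semigroup has an upper bound that is a limit of elements
subequivalent to its terms. -/
theorem exists_upper_bound {a : ℕ → Pos A} (ha : Monotone a) :
    ∃ b : Pos A, (∀ i, a i ≤ b) ∧ ConjLimit (Set.range fun i => (a i).val) b.val := by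
  obtain ⟨x, b, hx, hb, hab, hba⟩ := exists_conj_sequence (a := fun i => (a i).val)
    fun i j hij => CuntzLE.exists_of (ha hij)
  obtain ⟨s, hs, hsx, hss⟩ := exists_partial_isometries hx
  obtain ⟨c, hc, hbc⟩ := exists_bound_of_conj_sequence hb hs hsx hss
  have hac : ConjLimit (Set.range fun i => (a i).val) c := hbc.trans (by
    rintro _ ⟨j, rfl⟩
    exact hba j)
  refine ⟨⟨c, hac.exists_eq_star_mul_self ?_⟩, fun i => ConjLimit.cuntzLE ((hab i).trans ?_), hac⟩
  · rintro _ ⟨i, rfl⟩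
    exact (a i).pos
  · rintro _ ⟨j, rfl⟩ ε hε
    obtain ⟨d, hd⟩ := hc j
    exact ⟨c, rfl, d, by rwa [hd, sub_self, norm_zero]⟩

/-- The class of a projection is compact. -/
theorem wayBelow_mk_projection {p : Pos A} (hp : star p.val = p.val) (hpp : p.val * p.val = p.val) :
    WayBelow (Cu.mk p) (Cu.mk p) := by
  intro w hw hsup
  have hmk : ∀ i, ∃ a : Pos A, Cu.mk a = w i := fun i => by
    induction w i using Cu.ind with | _ a
    exact ⟨a, rfl⟩
  choose a ha using hmk
  have hmono : Monotone a := fun i j hij => by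
    have := hw hij
    rwa [← ha, ← ha] at this
  obtain ⟨b, hab, hb⟩ := exists_upper_bound hmono
  -- Leastness of the supremum is all that is needed: it transfers the approximation property of the
  -- particular bound `b` to `p`.
  have hpb : Cu.mk p ≤ Cu.mk b := hsup.2 (by
    rintro _ ⟨i, rfl⟩
    rw [← ha]
    exact hab i)
  obtain ⟨_, ⟨i, rfl⟩, d, hd⟩ := ((CuntzLE.conjLimit hpb).trans fun s hs => by
    rw [Set.mem_singleton_iff.1 hs]
    exact hb) (1 / 2) (by norm_num)
  refine ⟨i, ?_⟩
  rw [← ha]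
  refine (conjLimit_of_norm_sub_projection_le hp hpp ?_ hd.le).cuntzLE
  obtain ⟨c, hc⟩ := (a i).pos
  change star (a i).val = (a i).val
  rw [hc, star_mul, star_star]

variable (A) in
-- The unit class is represented by the projection `1 ⊗ e`, so the divisibility conditions can be
-- tested at `u' = u`.
theorem wayBelow_unit : WayBelow (Cu.unit A) (Cu.unit A) := by
  have h : star (unitMat A) = unitMat A := by
    conv_lhs => rw [unitMat_eq]
    rw [star_mul, star_star, ← unitMat_eq]
  refine wayBelow_mk_projection ?_ ?_
  · rw [← Stab.of_star, h]
  · have h2 := unitMat_eq (A := A)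
    rw [h] at h2
    rw [← Stab.of_mul, ← h2]

end IncreasingSequences

end CuntzDiv

/-! ### The three comparison statements -/

open CuntzDiv in
theorem mainTheorem10 {A : Type u} {B : Type v} [CStarAlgebra A] [CStarAlgebra B] (m n : ℕ)
    (hm : 1 ≤ m) (hmn : m < n) :
    (∀ x y : Cu A, n • x ≤ m • y → IsDivisible m n B →
      Cu.tensor x (Cu.unit B) ≤ Cu.tensor y (Cu.unit B)) ∧
    (∀ (x : Fin m → Cu A) (y : Cu A), (∀ j, n • x j ≤ y) → IsDecomposable m n B →
      Cu.tensor (∑ j, x j) (Cu.unit B) ≤ Cu.tensor y (Cu.unit B)) ∧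
    (∀ (x : Cu A) (y : Fin n → Cu A), (∀ j, x ≤ m • y j) → IsWeaklyDivisible m n B →
      Cu.tensor x (Cu.unit B) ≤ Cu.tensor (∑ j, y j) (Cu.unit B)) := by
  refine ⟨fun x y hxy hB => ?_, fun x y hxy hB => ?_, fun x y hxy hB => ?_⟩
  -- Compactness allows `u' = ⟨1_B⟩`, which gives `m • z ≤ ⟨1_B⟩ ≤ n • z`.
  · obtain ⟨z, hz1, hz2⟩ := hB _ (wayBelow_unit B)
    calc Cu.tensor x (Cu.unit B) ≤ Cu.tensor x (n • z) := Cu.tensor_mono le_rfl hz2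
      _ = Cu.tensor (n • x) z := by rw [Cu.tensor_nsmul, Cu.nsmul_tensor]
      _ ≤ Cu.tensor (m • y) z := Cu.tensor_mono hxy le_rfl
      _ = Cu.tensor y (m • z) := by rw [Cu.tensor_nsmul, Cu.nsmul_tensor]
      _ ≤ Cu.tensor y (Cu.unit B) := Cu.tensor_mono le_rfl hz1
  · obtain ⟨z, hz1, hz2⟩ := hB _ (wayBelow_unit B)
    -- Each `x j` is paired with its own `z j`, since `⟨1_B⟩ ≤ n • z j` for every `j`; the `z j` are
    -- summed only after every `n • x j` has been replaced by the common bound `y`.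
    calc Cu.tensor (∑ j, x j) (Cu.unit B) = ∑ j, Cu.tensor (x j) (Cu.unit B) :=
          Cu.sum_tensor _ _ _
      _ ≤ ∑ j, Cu.tensor (x j) (n • z j) :=
          Finset.sum_le_sum fun j _ => Cu.tensor_mono le_rfl (hz2 j)
      _ = ∑ j, Cu.tensor (n • x j) (z j) := by simp only [Cu.tensor_nsmul, Cu.nsmul_tensor]
      _ ≤ ∑ j, Cu.tensor y (z j) := Finset.sum_le_sum fun j _ => Cu.tensor_mono (hxy j) le_rfl
      _ = Cu.tensor y (∑ j, z j) := (Cu.tensor_sum _ _ _).symm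
      _ ≤ Cu.tensor y (Cu.unit B) := Cu.tensor_mono le_rfl hz1
  · obtain ⟨z, hz1, hz2⟩ := hB _ (wayBelow_unit B)
    -- Dually, `⟨1_B⟩` is split first, and the bound `x ≤ m • y j` is used against the matching `z
    -- j`.
    calc Cu.tensor x (Cu.unit B) ≤ Cu.tensor x (∑ j, z j) := Cu.tensor_mono le_rfl hz2
      _ = ∑ j, Cu.tensor x (z j) := Cu.tensor_sum _ _ _
      _ ≤ ∑ j, Cu.tensor (m • y j) (z j) :=
          Finset.sum_le_sum fun j _ => Cu.tensor_mono (hxy j) le_rfl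
      _ = ∑ j, Cu.tensor (y j) (m • z j) := by simp only [Cu.tensor_nsmul, Cu.nsmul_tensor]
      _ ≤ ∑ j, Cu.tensor (y j) (Cu.unit B) :=
          Finset.sum_le_sum fun j _ => Cu.tensor_mono le_rfl (hz1 j)
      _ = Cu.tensor (∑ j, y j) (Cu.unit B) := (Cu.sum_tensor _ _ _).symm
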